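/- **Setting.** Let $X$ be a 2-dimensional smooth (Hausdorff) manifold with a smooth Lorentzian metric, oriented and time-oriented. An open subset $Y\subseteq X$ is *globally hyperbolic* if it is strongly causal and $J_Y^+(p)\cap J_Y^-(q)$ is compact for all $p,q\in Y$, where $J_Y^\pm$ denotes causal future and past with respect to causal curves inside $Y$. *Causal subsets.* A *causal subset* of an open set $W\subseteq X$ is a set $O=\operatorname{int}\bigl(J_{Y'}^+(p)\cap J_{Y'}^-(q)\bigr)$ with $Y'\subseteq W$ globally hyperbolic and $p,q\in Y'$, for which $J_{Y'}^+(p)\cap J_{Y'}^-(q)$ is a causal diamond: a nondegenerate closed rectangle $[u_0,u_1]\times[v_0,v_1]$ in null coordinates $(u,v)$ defined near it, where $\partial_u$ is future-directed, lightlike and right-pointing and $\partial_v$ is future-directed, lightlike and left-pointing. Its left corner is $x=(u_0,v_1)$, its right corner is $y=(u_1,v_0)$; its past boundary is the path $x\to p\to y$ and its future boundary is the path $x\to q\to y$ along the sides. $S(W)$ is the poset of causal subsets of $W$ under inclusion. *Paths.* $P_2(X)$ is the strict 2-category whose objects are the points of $X$, whose 1-morphisms are the piecewise lightlike right-moving paths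 (up to reparametrization), and whose 2-morphisms are generated under gluing along common boundaries by the closures of causal subsets of $X$, each regarded as a 2-morphism from its future boundary to its past boundary; a glued region is determined by its upper and lower boundary path, so there is at most one 2-morphism between two given paths. *The net.* Let $C$ be a bicategory all of whose 2-morphisms are invertible and let $Z:P_2(X)\to C$ be a (pseudo) 2-functor. For $O\in S(X)$ with past boundary $\gamma_O:x\to y$ put $\mathcal A_Z(O)=\operatorname{End}_C(Z(\gamma_O))$. For $O'\subseteq O$ with corners $x',y'$ of $O'$, let $l:x\to x'$ be the path that runs along $\gamma_O$ to the lightlike projection of $x'$ and then up to $x'$, let $r:y'\to y$ be the path that runs down to the lightlike projection of $y'$ on $\gamma_O$ and then along $\gamma_O$, and let $f'$ be the 2-morphism from the composite path $x\xrightarrow{l}x'\xrightarrow{\gamma_{O'}}y'\xrightarrow{r}y$ to $\gamma_O$. Then $\mathcal A_Z(O')\to\mathcal A_Z(O)$ sends $a$ to $Z(f')\circ a'\circ Z(f')^{-1}$, where $a'$ is $a$ whiskered with $Z(l)$ and $Z(r)$ (and transported along the coherence isomorphisms of $Z$). *Axioms.* Let $Y\subseteq X$ be open. An assignment $\mathcal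 A$ of monoids to the objects and of homomorphisms to the inclusions of $S(Y)$ is a *net* if it is a functor that sends all inclusions to injections. The net is *local* if for $O_1,O_2\subseteq O$ in $S(Y)$ such that no point of $O_1$ is joined to a point of $O_2$ by a causal curve in $Y$, the images of $\mathcal A(O_1)$ and $\mathcal A(O_2)$ in $\mathcal A(O)$ commute. It satisfies the *time-slice axiom* if, for every $O\in S(Y)$, every Cauchy surface $\Sigma$ of $O$ (a subset met exactly once by every inextendible causal curve in $O$) and every collection of causal subsets $O_i\subseteq O$ in $S(Y)$ covering $\Sigma$, the union of the images of the $\mathcal A(O_i)$ in $\mathcal A(O)$ is $\mathcal A(O)$. **Proposition.** 1. If $C$ is a 2-groupoid (all 1-morphisms are invertible up to 2-isomorphism, and all 2-morphisms are invertible), then $\mathcal A_Z$ is a net on $S(X)$, and for every globally hyperbolic open subset $Y\subseteq X$ its restriction to $S(Y)$ is a local net that satisfies the time-slice axiom. That is, $\mathcal A_Z$ is locally local and satisfies the local time-slice axiom. 2. If only the 2-morphisms of $C$ are assumed to be invertible, but horizontal composition with the images under $Z$ of 1-morphisms is injective on 2-morphisms of $C$, then $\mathcal A_Z$ is still a net on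 $S(X)$, and for every globally hyperbolic open subset $Y\subseteq X$ its restriction to $S(Y)$ is a local net. -/

import Mathlib

open Set Filter Topology CategoryTheory
open scoped Manifold ContDiff Bicategory

universe u w w₁ v₁ u₁

noncomputable section

/-! ### Oriented and time-oriented Lorentzian surfaces -/

/-- A smooth Lorentzian metric of signature `(-,+)` on the surface `X`, together with a time
orientation (given by a timelike vector field) and an orientation (given by a nowhere vanishing
2-form). In dimension two a quadratic form that takes both signs is nondegenerate of
signature `(1,1)`. -/
structure LorentzSurface (X : Type u) [TopologicalSpace X]
    [ChartedSpace (EuclideanSpace ℝ (Fin 2)) X] [IsManifold (𝓡 2) ∞ X] where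
  /-- the metric -/
  g (x : X) : TangentSpace (𝓡 2) x →L[ℝ] TangentSpace (𝓡 2) x →L[ℝ] ℝ
  g_symm (x : X) (v w : TangentSpace (𝓡 2) x) : g x v w = g x w v
  g_smooth : ContMDiff (𝓡 2)
    ((𝓡 2).prod 𝓘(ℝ, EuclideanSpace ℝ (Fin 2) →L[ℝ] EuclideanSpace ℝ (Fin 2) →L[ℝ] ℝ)) ∞
    (fun x ↦ Bundle.TotalSpace.mk'
      (EuclideanSpace ℝ (Fin 2) →L[ℝ] EuclideanSpace ℝ (Fin 2) →L[ℝ] ℝ) x (g x))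
  exists_spacelike (x : X) : ∃ v : TangentSpace (𝓡 2) x, 0 < g x v v
  /-- the time orientation -/
  T (x : X) : TangentSpace (𝓡 2) x
  T_timelike (x : X) : g x (T x) (T x) < 0
  T_continuous : Continuous (fun x ↦ (⟨x, T x⟩ : TangentBundle (𝓡 2) X))
  /-- the orientation -/
  vol (x : X) : TangentSpace (𝓡 2) x →L[ℝ] TangentSpace (𝓡 2) x →L[ℝ] ℝ
  vol_alternating (x : X) (v : TangentSpace (𝓡 2) x) : vol x v v = 0
  vol_ne_zero (x : X) : vol x ≠ 0
  vol_continuous : Continuous (fun x ↦ Bundle.TotalSpace.mk'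
      (EuclideanSpace ℝ (Fin 2) →L[ℝ] EuclideanSpace ℝ (Fin 2) →L[ℝ] ℝ) x (vol x))

variable {X : Type u} [TopologicalSpace X]
  [ChartedSpace (EuclideanSpace ℝ (Fin 2)) X] [IsManifold (𝓡 2) ∞ X]

/-- The curve `γ`, restricted to `s`, has velocity `v` at the parameter `t`. -/
def HasVelocity (γ : ℝ → X) (s : Set ℝ) (t : ℝ) (v : TangentSpace (𝓡 2) (γ t)) : Prop :=
  HasMFDerivWithinAt 𝓘(ℝ, ℝ) (𝓡 2) γ s t ((1 : ℝ →L[ℝ] ℝ).smulRight v)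

namespace LorentzSurface

variable (M : LorentzSurface X)

/-- Nonzero null vectors. -/
def Lightlike {x : X} (v : TangentSpace (𝓡 2) x) : Prop := v ≠ 0 ∧ M.g x v v = 0

/-- Nonzero timelike or lightlike vectors that point to the future. -/
def FutureCausal {x : X} (v : TangentSpace (𝓡 2) x) : Prop :=
  v ≠ 0 ∧ M.g x v v ≤ 0 ∧ M.g x v (M.T x) < 0

/-- `v` points to the right: the pair (`v`, future) is positively oriented. -/
def Rightward {x : X} (v : TangentSpace (𝓡 2) x) : Prop := 0 < M.vol x v (M.T x)

/-- `v` points to the left. -/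
def Leftward {x : X} (v : TangentSpace (𝓡 2) x) : Prop := M.vol x v (M.T x) < 0

/-! ### Causality -/

/-- `q` is reached from `p` by a `C¹` future-directed causal curve that stays in `Y`. -/
def CausalStep (Y : Set X) (p q : X) : Prop :=
  ∃ (γ : ℝ → X) (a b : ℝ), a < b ∧ γ a = p ∧ γ b = q ∧
    ContMDiffOn 𝓘(ℝ, ℝ) (𝓡 2) 1 γ (Icc a b) ∧
    ∀ t ∈ Icc a b, γ t ∈ Y ∧ ∃ v, HasVelocity γ (Icc a b) t v ∧ M.FutureCausal v

/-- The causal order of `Y`: `p = q`, or `q` is reached from `p` by a piecewise `C¹`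
future-directed causal curve in `Y`. -/
def CausalLE (Y : Set X) : X → X → Prop := Relation.ReflTransGen (M.CausalStep Y)

/-- The causal future of `p` in `Y`. -/
def future (Y : Set X) (p : X) : Set X := {r | M.CausalLE Y p r}

/-- The causal past of `q` in `Y`. -/
def past (Y : Set X) (q : X) : Set X := {r | M.CausalLE Y r q}

/-- An open subset `Y` that is globally hyperbolic in its own right: strongly causal (causal curves
of `Y` that start and end close to a point stay close to it), with compact causal intervals. -/
structure GloballyHyperbolic (Y : Set X) : Prop where
  isOpen : IsOpen Y
  stronglyCausal : ∀ p ∈ Y, ∀ U ∈ 𝓝 p, ∃ V ∈ 𝓝 p, ∀ a ∈ V ∩ Y, ∀ b ∈ V ∩ Y, ∀ c,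
    M.CausalLE Y a c → M.CausalLE Y c b → c ∈ U
  isCompact : ∀ p ∈ Y, ∀ q ∈ Y, IsCompact (M.future Y p ∩ M.past Y q)

/-- Two subsets are spacelike separated in `Y` if no point of the one is joined to a point of the
other by a causal curve in `Y`. -/
def SpacelikeSeparated (Y O₁ O₂ : Set X) : Prop :=
  ∀ x₁ ∈ O₁, ∀ x₂ ∈ O₂, ¬ M.CausalLE Y x₁ x₂ ∧ ¬ M.CausalLE Y x₂ x₁

/-- A causal curve in `O` without endpoints in `O`. -/
structure InextendibleCausalCurve (O : Set X) (γ : ℝ → X) : Prop where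
  contMDiff : ContMDiff 𝓘(ℝ, ℝ) (𝓡 2) 1 γ
  mem (t : ℝ) : γ t ∈ O
  causal (t : ℝ) : ∃ v, HasVelocity γ univ t v ∧ M.FutureCausal v
  no_future_endpoint : ∀ r ∈ O, ¬ Tendsto γ atTop (𝓝 r)
  no_past_endpoint : ∀ r ∈ O, ¬ Tendsto γ atBot (𝓝 r)

/-- A Cauchy surface of `O`: a subset that every inextendible causal curve in `O` meets
exactly once. -/
def IsCauchySurface (O Sig : Set X) : Prop :=
  Sig ⊆ O ∧ ∀ γ, M.InextendibleCausalCurve O γ → ∃! t, γ t ∈ Sig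

/-! ### Causal subsets -/

/-- The differential at `z` of the inverse of a chart: it sends `(1, 0)` and `(0, 1)` to the
coordinate vectors. -/
def frame (e : OpenPartialHomeomorph X (ℝ × ℝ)) (z : ℝ × ℝ) :
    ℝ × ℝ →L[ℝ] TangentSpace (𝓡 2) (e.symm z) :=
  mfderiv 𝓘(ℝ, ℝ × ℝ) (𝓡 2) e.symm z

/-- Null coordinates `(u, v)` on an open part of `X`: the coordinate lines of `u` are lightlike
and run to the future and to the right, those of `v` are lightlike and run to the future and
to the left. -/
structure NullChart where
  toChart : OpenPartialHomeomorph X (ℝ × ℝ)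
  smooth : ContMDiffOn (𝓡 2) 𝓘(ℝ, ℝ × ℝ) ∞ toChart toChart.source
  smooth_symm : ContMDiffOn 𝓘(ℝ, ℝ × ℝ) (𝓡 2) ∞ toChart.symm toChart.target
  du_lightlike : ∀ z ∈ toChart.target, M.Lightlike (frame toChart z (1, 0))
  du_future : ∀ z ∈ toChart.target, M.FutureCausal (frame toChart z (1, 0))
  du_right : ∀ z ∈ toChart.target, M.Rightward (frame toChart z (1, 0))
  dv_lightlike : ∀ z ∈ toChart.target, M.Lightlike (frame toChart z (0, 1))
  dv_future : ∀ z ∈ toChart.target, M.FutureCausal (frame toChart z (0, 1))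
  dv_left : ∀ z ∈ toChart.target, M.Leftward (frame toChart z (0, 1))

/-- A causal diamond: two points `p`, `q` of a globally hyperbolic subset `Y` for which the
intersection of the future of `p` with the past of `q` is a (nondegenerate) rectangle with lightlike
sides, that is, a rectangle in null coordinates. This rules out intersections without a left and a
right corner, such as those that wrap around a cylinder. -/
structure CausalDiamond where
  Y : Set X
  hyperbolic : M.GloballyHyperbolic Y
  p : X
  q : X
  p_mem : p ∈ Y
  q_mem : q ∈ Y
  chart : NullChart M
  u₀ : ℝ
  u₁ : ℝ
  v₀ : ℝ
  v₁ : ℝ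
  u_lt : u₀ < u₁
  v_lt : v₀ < v₁
  rect_subset : Icc u₀ u₁ ×ˢ Icc v₀ v₁ ⊆ chart.toChart.target
  p_eq : chart.toChart.symm (u₀, v₀) = p
  q_eq : chart.toChart.symm (u₁, v₁) = q
  inter_eq : M.future Y p ∩ M.past Y q = chart.toChart.symm '' (Icc u₀ u₁ ×ˢ Icc v₀ v₁)

/-- The causal subset of a causal diamond: the interior of the intersection of the future of `p`
with the past of `q`. -/
def CausalDiamond.region {M : LorentzSurface X} (D : CausalDiamond M) : Set X :=
  interior (M.future D.Y D.p ∩ M.past D.Y D.q)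

/-! ### The 2-category of paths -/

/-- A piece of a path: a `C¹` lightlike right-moving curve, or a constant curve (`a = b`). -/
structure Segment (x y : X) where
  γ : ℝ → X
  a : ℝ
  b : ℝ
  le : a ≤ b
  source_eq : γ a = x
  target_eq : γ b = y
  contMDiffOn : ContMDiffOn 𝓘(ℝ, ℝ) (𝓡 2) 1 γ (Icc a b)
  lightlike : a < b → ∀ t ∈ Icc a b,
    ∃ v, HasVelocity γ (Icc a b) t v ∧ M.Lightlike v ∧ M.Rightward v

/-- The points of `X`, as vertices of the quiver of lightlike right-moving segments. -/
def Vertex (_ : LorentzSurface X) : Type u := X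

instance : Quiver (Vertex M) := ⟨fun x y ↦ Segment M (show X from x) (show X from y)⟩

/-- A segment as a one-letter word. -/
def Segment.word {M : LorentzSurface X} {x y : X} (s : Segment M x y) :
    (show Paths (Vertex M) from x) ⟶ (show Paths (Vertex M) from y) :=
  (Paths.of (Vertex M)).map s

/-- Two words of segments describe the same path: this is generated by reparametrization,
by cutting a segment into two, and by dropping constant segments. -/
inductive SamePath : HomRel (Paths (Vertex M))
  | reparam {x y : X} (s s' : Segment M x y) (φ : ℝ → ℝ) (hc : ContinuousOn φ (Icc s.a s.b))
      (hm : StrictMonoOn φ (Icc s.a s.b)) (ha : φ s.a = s'.a) (hb : φ s.b = s'.b)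
      (h : ∀ t ∈ Icc s.a s.b, s.γ t = s'.γ (φ t)) : SamePath s.word s'.word
  | cut {x y z : X} (s : Segment M x z) (s₁ : Segment M x y) (s₂ : Segment M y z)
      (ha : s₁.a = s.a) (hc : s₁.b = s₂.a) (hb : s₂.b = s.b)
      (h₁ : EqOn s₁.γ s.γ (Icc s₁.a s₁.b)) (h₂ : EqOn s₂.γ s.γ (Icc s₂.a s₂.b)) :
      SamePath s.word (s₁.word ≫ s₂.word)
  | const {x : X} (s : Segment M x x) (h : s.a = s.b) : SamePath s.word (𝟙 _)

/-- The objects of the path 2-category: the points of `X`. -/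
@[ext]
structure PathTwoCat (M : LorentzSurface X) where
  pt : X

/-- The 1-morphisms are the piecewise lightlike right-moving paths, up to reparametrization. -/
instance : Category (PathTwoCat M) where
  Hom x y := (⟨(show Paths (Vertex M) from x.pt)⟩ : CategoryTheory.Quotient (SamePath M)) ⟶
    (⟨(show Paths (Vertex M) from y.pt)⟩ : CategoryTheory.Quotient (SamePath M))
  id x := 𝟙 (⟨(show Paths (Vertex M) from x.pt)⟩ : CategoryTheory.Quotient (SamePath M))
  comp f g := CategoryStruct.comp (obj := CategoryTheory.Quotient (SamePath M)) f g
  id_comp f := Category.id_comp (obj := CategoryTheory.Quotient (SamePath M)) f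
  comp_id f := Category.comp_id (obj := CategoryTheory.Quotient (SamePath M)) f
  assoc f g h := Category.assoc (obj := CategoryTheory.Quotient (SamePath M)) f g h

variable {M}

/-- The path that consists of one segment. -/
def Segment.path {x y : X} (s : Segment M x y) :
    (⟨x⟩ : PathTwoCat M) ⟶ ⟨y⟩ :=
  (CategoryTheory.Quotient.functor (SamePath M)).map s.word

lemma Segment.path_reparam {x y : X} (s s' : Segment M x y) (φ : ℝ → ℝ)
    (hc : ContinuousOn φ (Icc s.a s.b))
    (hm : StrictMonoOn φ (Icc s.a s.b)) (ha : φ s.a = s'.a) (hb : φ s.b = s'.b)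
    (h : ∀ t ∈ Icc s.a s.b, s.γ t = s'.γ (φ t)) : s.path = s'.path :=
  CategoryTheory.Quotient.sound _ (SamePath.reparam s s' φ hc hm ha hb h)

lemma Segment.path_cut {x y z : X} (s : Segment M x z) (s₁ : Segment M x y) (s₂ : Segment M y z)
    (ha : s₁.a = s.a) (hc : s₁.b = s₂.a) (hb : s₂.b = s.b)
    (h₁ : EqOn s₁.γ s.γ (Icc s₁.a s₁.b)) (h₂ : EqOn s₂.γ s.γ (Icc s₂.a s₂.b)) :
    s.path = s₁.path ≫ s₂.path :=
  CategoryTheory.Quotient.sound _ (SamePath.cut s s₁ s₂ ha hc hb h₁ h₂)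

lemma Segment.path_const {x : X} (s : Segment M x x) (h : s.a = s.b) : s.path = 𝟙 _ :=
  CategoryTheory.Quotient.sound _ (SamePath.const s h)

namespace NullChart

variable (e : NullChart M)

lemma mdifferentiableAt_symm {z : ℝ × ℝ} (hz : z ∈ e.toChart.target) :
    MDifferentiableAt 𝓘(ℝ, ℝ × ℝ) (𝓡 2) e.toChart.symm z :=
  ((e.smooth_symm z hz).contMDiffAt (e.toChart.open_target.mem_nhds hz)).mdifferentiableAt
    (by simp)

lemma mdifferentiableAt {x : X} (hx : x ∈ e.toChart.source) :
    MDifferentiableAt (𝓡 2) 𝓘(ℝ, ℝ × ℝ) e.toChart x :=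
  ((e.smooth x hx).contMDiffAt (e.toChart.open_source.mem_nhds hx)).mdifferentiableAt
    (by simp)

/-- A `C¹` curve in coordinates. -/
lemma curve_contMDiffOn {c : ℝ → ℝ × ℝ} {s : Set ℝ} (hc : ContDiff ℝ 1 c)
    (hs : ∀ t ∈ s, c t ∈ e.toChart.target) :
    ContMDiffOn 𝓘(ℝ, ℝ) (𝓡 2) 1 (fun t ↦ e.toChart.symm (c t)) s :=
  ContMDiffOn.comp (e.smooth_symm.of_le (by simp)) hc.contMDiff.contMDiffOn hs

lemma curve_hasVelocity {c : ℝ → ℝ × ℝ} {s : Set ℝ} {t : ℝ} {d : ℝ × ℝ} (hc : HasDerivAt c d t)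
    (ht : c t ∈ e.toChart.target) :
    HasVelocity (fun t ↦ e.toChart.symm (c t)) s t (frame e.toChart (c t) d) := by
  have h1 : HasMFDerivWithinAt 𝓘(ℝ, ℝ) 𝓘(ℝ, ℝ × ℝ) c s t
      ((1 : ℝ →L[ℝ] ℝ).smulRight d : ℝ →L[ℝ] ℝ × ℝ) :=
    hc.hasFDerivAt.hasFDerivWithinAt.hasMFDerivWithinAt
  have h2 := (e.mdifferentiableAt_symm ht).hasMFDerivAt.comp_hasMFDerivWithinAt t h1
  have h3 : (mfderiv 𝓘(ℝ, ℝ × ℝ) (𝓡 2) e.toChart.symm (c t)).comp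
      ((1 : ℝ →L[ℝ] ℝ).smulRight d : ℝ →L[ℝ] ℝ × ℝ) =
      ((1 : ℝ →L[ℝ] ℝ).smulRight (frame e.toChart (c t) d) :
        ℝ →L[ℝ] TangentSpace (𝓡 2) (e.toChart.symm (c t))) := by
    ext1
    change frame e.toChart (c t) ((1 : ℝ) • d) = (1 : ℝ) • frame e.toChart (c t) d
    rw [map_smul]
  unfold HasVelocity
  exact h3 ▸ h2

/-- The segment along a coordinate line of `u`, from `(u₁, v)` up to the right to `(u₂, v)`. -/
def upSegment {u₁ u₂ v : ℝ} (h : u₁ ≤ u₂)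
    (ht : ∀ u ∈ Icc u₁ u₂, (u, v) ∈ e.toChart.target) {x y : X}
    (hx : e.toChart.symm (u₁, v) = x) (hy : e.toChart.symm (u₂, v) = y) : Segment M x y where
  γ t := e.toChart.symm (t, v)
  a := u₁
  b := u₂
  le := h
  source_eq := hx
  target_eq := hy
  contMDiffOn := e.curve_contMDiffOn (c := fun t ↦ (t, v)) (by fun_prop) ht
  lightlike _ t h := by
    have hd : HasDerivAt (fun t : ℝ ↦ (t, v)) (1, 0) t :=
      (hasDerivAt_id t).prodMk (hasDerivAt_const t v)
    exact ⟨_, e.curve_hasVelocity hd (ht t h), e.du_lightlike _ (ht t h), e.du_right _ (ht t h)⟩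

/-- The segment along a coordinate line of `v`, from `(u, v₁)` down to the right to `(u, v₂)`. -/
def downSegment {u v₁ v₂ : ℝ} (h : v₂ ≤ v₁)
    (ht : ∀ v ∈ Icc v₂ v₁, (u, v) ∈ e.toChart.target) {x y : X}
    (hx : e.toChart.symm (u, v₁) = x) (hy : e.toChart.symm (u, v₂) = y) : Segment M x y where
  γ t := e.toChart.symm (u, -t)
  a := -v₁
  b := -v₂
  le := neg_le_neg h
  source_eq := by simpa using hx
  target_eq := by simpa using hy
  contMDiffOn := e.curve_contMDiffOn (c := fun t ↦ (u, -t)) (by fun_prop)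
    fun t h ↦ ht _ ⟨by linarith [h.2], by linarith [h.1]⟩
  lightlike _ t h := by
    have hd : HasDerivAt (fun t : ℝ ↦ (u, -t)) (0, -1) t :=
      (hasDerivAt_const t u).prodMk (hasDerivAt_neg t)
    have hm := ht (-t) ⟨by linarith [h.2], by linarith [h.1]⟩
    have hn : ((0, -1) : ℝ × ℝ) = -(0, 1) := by simp
    refine ⟨_, e.curve_hasVelocity hd hm, ?_, ?_⟩
    · obtain ⟨h1, h2⟩ := e.dv_lightlike _ hm
      rw [hn]
      constructor
      · rw [map_neg]; exact neg_ne_zero.mpr h1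
      · simp only [map_neg, neg_apply, h2, neg_zero]
    · have h3 := e.dv_left _ hm
      rw [hn]
      unfold Leftward at h3
      unfold Rightward
      rw [map_neg, map_neg, neg_apply]
      linarith

end NullChart

namespace CausalDiamond

variable (D : CausalDiamond M)

/-- The left corner. -/
def left : X := D.chart.toChart.symm (D.u₀, D.v₁)

/-- The right corner. -/
def right : X := D.chart.toChart.symm (D.u₁, D.v₀)

lemma left_eq : D.chart.toChart.symm (D.u₀, D.v₁) = D.left := rfl

lemma right_eq : D.chart.toChart.symm (D.u₁, D.v₀) = D.right := rfl

lemma mem_target {u v : ℝ} (hu : u ∈ Icc D.u₀ D.u₁) (hv : v ∈ Icc D.v₀ D.v₁) :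
    (u, v) ∈ D.chart.toChart.target := D.rect_subset ⟨hu, hv⟩

/-- The path up to the right from `(u₁, v)` to `(u₂, v)` in the closed diamond. -/
def up {u₁ u₂ v : ℝ} (h₁ : D.u₀ ≤ u₁) (h : u₁ ≤ u₂) (h₂ : u₂ ≤ D.u₁) (hv₀ : D.v₀ ≤ v)
    (hv₁ : v ≤ D.v₁) {x y : X} (hx : D.chart.toChart.symm (u₁, v) = x)
    (hy : D.chart.toChart.symm (u₂, v) = y) : (⟨x⟩ : PathTwoCat M) ⟶ ⟨y⟩ :=
  (D.chart.upSegment h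
    (fun _ hu ↦ D.mem_target ⟨h₁.trans hu.1, hu.2.trans h₂⟩ ⟨hv₀, hv₁⟩) hx hy).path

/-- The path down to the right from `(u, v₁)` to `(u, v₂)` in the closed diamond. -/
def down {u v₁ v₂ : ℝ} (h₁ : v₁ ≤ D.v₁) (h : v₂ ≤ v₁) (h₂ : D.v₀ ≤ v₂) (hu₀ : D.u₀ ≤ u)
    (hu₁ : u ≤ D.u₁) {x y : X} (hx : D.chart.toChart.symm (u, v₁) = x)
    (hy : D.chart.toChart.symm (u, v₂) = y) : (⟨x⟩ : PathTwoCat M) ⟶ ⟨y⟩ :=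
  (D.chart.downSegment h
    (fun _ hv ↦ D.mem_target ⟨hu₀, hu₁⟩ ⟨h₂.trans hv.1, hv.2.trans h₁⟩) hx hy).path

/-- The past boundary, from the left corner over `p` to the right corner. -/
def pastBoundary : (⟨D.left⟩ : PathTwoCat M) ⟶ ⟨D.right⟩ :=
  D.down (u := D.u₀) le_rfl D.v_lt.le le_rfl le_rfl D.u_lt.le D.left_eq D.p_eq ≫
    D.up (v := D.v₀) le_rfl D.u_lt.le le_rfl le_rfl D.v_lt.le D.p_eq D.right_eq

/-- The future boundary, from the left corner over `q` to the right corner. -/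
def futureBoundary : (⟨D.left⟩ : PathTwoCat M) ⟶ ⟨D.right⟩ :=
  D.up (v := D.v₁) le_rfl D.u_lt.le le_rfl D.v_lt.le le_rfl D.left_eq D.q_eq ≫
    D.down (u := D.u₁) le_rfl D.v_lt.le le_rfl D.u_lt.le le_rfl D.q_eq D.right_eq

end CausalDiamond

/-- `Sweep f g`: a 2-morphism from `f` down to `g` can be glued from closed causal diamonds, each of
them a 2-morphism from its future boundary to its past boundary. -/
inductive Sweep : ∀ {x y : PathTwoCat M}, (x ⟶ y) → (x ⟶ y) → Prop
  | refl {x y : PathTwoCat M} (f : x ⟶ y) : Sweep f f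
  | trans {x y : PathTwoCat M} {f g h : x ⟶ y} : Sweep f g → Sweep g h → Sweep f h
  | diamond {x y : PathTwoCat M} (D : CausalDiamond M) (l : x ⟶ ⟨D.left⟩) (r : ⟨D.right⟩ ⟶ y) :
      Sweep (l ≫ D.futureBoundary ≫ r) (l ≫ D.pastBoundary ≫ r)

lemma Sweep.whiskerLeft {x y z : PathTwoCat M} (l : x ⟶ y) {f g : y ⟶ z} (h : Sweep f g) :
    Sweep (l ≫ f) (l ≫ g) := by
  induction h with
  | refl f => exact .refl _
  | trans _ _ ih₁ ih₂ => exact .trans ih₁ ih₂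
  | diamond D l' r => simpa using Sweep.diamond D (l ≫ l') r

lemma Sweep.whiskerRight {x y z : PathTwoCat M} {f g : x ⟶ y} (h : Sweep f g) (r : y ⟶ z) :
    Sweep (f ≫ r) (g ≫ r) := by
  induction h with
  | refl f => exact .refl _
  | trans _ _ ih₁ ih₂ => exact .trans ih₁ ih₂
  | diamond D l r' => simpa using Sweep.diamond D l (r' ≫ r)

variable (M) in
/-- 2-morphisms. A region that is glued from closed diamonds is determined by its upper and its
lower boundary path, so there is at most one 2-morphism between two given paths. -/
instance homCategory (x y : PathTwoCat M) : Category (x ⟶ y) where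
  Hom f g := PLift (Sweep f g)
  id f := ⟨.refl f⟩
  comp h k := ⟨h.down.trans k.down⟩

instance (x y : PathTwoCat M) : Quiver.IsThin (x ⟶ y) :=
  fun _ _ ↦ ⟨fun ⟨_⟩ ⟨_⟩ ↦ rfl⟩

variable (M) in
/-- The strict 2-category of paths. -/
instance : Bicategory (PathTwoCat M) where
  homCategory := homCategory M
  whiskerLeft l _ _ h := ⟨h.down.whiskerLeft l⟩
  whiskerRight h r := ⟨h.down.whiskerRight r⟩
  associator f g h := eqToIso (Category.assoc f g h)
  leftUnitor f := eqToIso (Category.id_comp f)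
  rightUnitor f := eqToIso (Category.comp_id f)
  whiskerLeft_id := by intros; exact Subsingleton.elim _ _
  whiskerLeft_comp := by intros; exact Subsingleton.elim _ _
  id_whiskerLeft := by intros; exact Subsingleton.elim _ _
  comp_whiskerLeft := by intros; exact Subsingleton.elim _ _
  id_whiskerRight := by intros; exact Subsingleton.elim _ _
  comp_whiskerRight := by intros; exact Subsingleton.elim _ _
  whiskerRight_id := by intros; exact Subsingleton.elim _ _
  whiskerRight_comp := by intros; exact Subsingleton.elim _ _
  whisker_assoc := by intros; exact Subsingleton.elim _ _
  whisker_exchange := by intros; exact Subsingleton.elim _ _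
  pentagon := by intros; exact Subsingleton.elim _ _
  triangle := by intros; exact Subsingleton.elim _ _

instance : Bicategory.Strict (PathTwoCat M) where
  id_comp := Category.id_comp
  comp_id := Category.comp_id
  assoc := Category.assoc
  leftUnitor_eqToIso _ := rfl
  rightUnitor_eqToIso _ := rfl
  associator_eqToIso _ _ _ := rfl

/-! ### Null coordinates and the causal order -/

namespace NullChart

variable (e : NullChart M)

/-- The differential of the chart. -/
def coframe (x : X) : TangentSpace (𝓡 2) x →L[ℝ] ℝ × ℝ :=
  mfderiv (𝓡 2) 𝓘(ℝ, ℝ × ℝ) e.toChart x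

lemma coframe_frame {z : ℝ × ℝ} (hz : z ∈ e.toChart.target) (d : ℝ × ℝ) :
    e.coframe (e.toChart.symm z) (frame e.toChart z d) = d := by
  have h1 := (e.mdifferentiableAt (e.toChart.map_target hz)).hasMFDerivAt.comp z
    (e.mdifferentiableAt_symm hz).hasMFDerivAt
  have h2 : HasMFDerivAt 𝓘(ℝ, ℝ × ℝ) 𝓘(ℝ, ℝ × ℝ) (e.toChart ∘ e.toChart.symm) z
      (ContinuousLinearMap.id ℝ (ℝ × ℝ)) := by
    refine (hasMFDerivAt_id z).congr_of_eventuallyEq ?_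
    filter_upwards [e.toChart.open_target.mem_nhds hz] with y hy
    exact e.toChart.right_inv hy
  have h3 := hasMFDerivAt_unique h1 h2
  exact congrArg (fun f : ℝ × ℝ →L[ℝ] ℝ × ℝ ↦ f d) h3

lemma exists_frame {z : ℝ × ℝ} (hz : z ∈ e.toChart.target)
    (w : TangentSpace (𝓡 2) (e.toChart.symm z)) : ∃ d, frame e.toChart z d = w := by
  have hinj : Function.Injective (frame e.toChart z).toLinearMap := fun a b h ↦ by
    rw [← e.coframe_frame hz a, ← e.coframe_frame hz b]
    exact congrArg _ h
  have hf : Module.finrank ℝ (ℝ × ℝ) =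
      Module.finrank ℝ (TangentSpace (𝓡 2) (e.toChart.symm z)) := by
    change _ = Module.finrank ℝ (EuclideanSpace ℝ (Fin 2))
    simp
  have : FiniteDimensional ℝ (TangentSpace (𝓡 2) (e.toChart.symm z)) :=
    inferInstanceAs (FiniteDimensional ℝ (EuclideanSpace ℝ (Fin 2)))
  exact (LinearMap.injective_iff_surjective_of_finrank_eq_finrank hf).mp hinj w

lemma frame_eq (z d : ℝ × ℝ) :
    frame e.toChart z d = d.1 • frame e.toChart z (1, 0) + d.2 • frame e.toChart z (0, 1) := by
  rw [← map_smul, ← map_smul, ← map_add]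
  simp

lemma g_frame {z : ℝ × ℝ} (hz : z ∈ e.toChart.target) (d d' : ℝ × ℝ) :
    M.g _ (frame e.toChart z d) (frame e.toChart z d') =
      (d.1 * d'.2 + d.2 * d'.1) *
        M.g _ (frame e.toChart z (1, 0)) (frame e.toChart z (0, 1)) := by
  have h1 := (e.du_lightlike z hz).2
  have h2 := (e.dv_lightlike z hz).2
  have h3 := M.g_symm _ (frame e.toChart z (0, 1)) (frame e.toChart z (1, 0))
  rw [e.frame_eq z d, e.frame_eq z d']
  simp only [map_add, map_smul, add_apply, smul_apply, h1, h2, h3, smul_eq_mul]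
  ring

lemma g_frame_neg {z : ℝ × ℝ} (hz : z ∈ e.toChart.target) :
    M.g _ (frame e.toChart z (1, 0)) (frame e.toChart z (0, 1)) < 0 := by
  obtain ⟨τ, hτ⟩ := e.exists_frame hz (M.T _)
  have h1 := (e.du_future z hz).2.2
  have h2 := (e.dv_future z hz).2.2
  have h3 := M.T_timelike (e.toChart.symm z)
  rw [← hτ, e.g_frame hz] at h1 h2 h3
  simp only [one_mul, zero_mul, add_zero, zero_add] at h1 h2
  nlinarith [mul_pos_of_neg_of_neg h1 h2]

lemma nonneg_of_futureCausal_frame {z : ℝ × ℝ} (hz : z ∈ e.toChart.target) {d : ℝ × ℝ}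
    (h : M.FutureCausal (frame e.toChart z d)) : 0 ≤ d.1 ∧ 0 ≤ d.2 := by
  obtain ⟨-, h1, h2⟩ := h
  have hm := e.g_frame_neg hz
  have ha := (e.du_future z hz).2.2
  have hb := (e.dv_future z hz).2.2
  rw [e.g_frame hz] at h1
  rw [e.frame_eq z d] at h2
  simp only [map_add, map_smul, add_apply, smul_apply, smul_eq_mul] at h2
  have h3 : 0 ≤ d.1 * d.2 := by nlinarith
  constructor <;> by_contra! hc
  · have h4 : d.2 ≤ 0 := by by_contra! h5; nlinarith
    nlinarith
  · have h4 : d.1 ≤ 0 := by by_contra! h5; nlinarith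
    nlinarith

lemma futureCausal_frame {z : ℝ × ℝ} (hz : z ∈ e.toChart.target) {d : ℝ × ℝ}
    (h1 : 0 ≤ d.1) (h2 : 0 ≤ d.2) (hd : d ≠ 0) : M.FutureCausal (frame e.toChart z d) := by
  have hm := e.g_frame_neg hz
  have ha := (e.du_future z hz).2.2
  have hb := (e.dv_future z hz).2.2
  have h3 : 0 < d.1 ∨ 0 < d.2 := by
    by_contra! hc
    exact hd (Prod.ext (le_antisymm hc.1 h1) (le_antisymm hc.2 h2))
  refine ⟨fun h0 ↦ hd ?_, ?_, ?_⟩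
  · rw [← e.coframe_frame hz d, h0, map_zero]
  · rw [e.g_frame hz]
    nlinarith [mul_nonneg h1 h2]
  · rw [e.frame_eq z d]
    simp only [map_add, map_smul, add_apply, smul_apply, smul_eq_mul]
    rcases h3 with h3 | h3 <;> nlinarith

lemma exists_of_mem_source {x : X} (hx : x ∈ e.toChart.source) :
    ∃ z ∈ e.toChart.target, e.toChart.symm z = x :=
  ⟨_, e.toChart.map_source hx, e.toChart.left_inv hx⟩

lemma coframe_nonneg {x : X} (hx : x ∈ e.toChart.source) {v : TangentSpace (𝓡 2) x}
    (h : M.FutureCausal v) : 0 ≤ (e.coframe x v).1 ∧ 0 ≤ (e.coframe x v).2 := by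
  obtain ⟨z, hz, rfl⟩ := e.exists_of_mem_source hx
  obtain ⟨d, rfl⟩ := e.exists_frame hz v
  rw [e.coframe_frame hz]
  exact e.nonneg_of_futureCausal_frame hz h

lemma coframe_right {x : X} (hx : x ∈ e.toChart.source) {v : TangentSpace (𝓡 2) x}
    (h : M.FutureCausal v) (hl : M.Lightlike v) (hr : M.Rightward v) :
    0 < (e.coframe x v).1 ∧ (e.coframe x v).2 = 0 := by
  obtain ⟨z, hz, rfl⟩ := e.exists_of_mem_source hx
  obtain ⟨d, rfl⟩ := e.exists_frame hz v
  rw [e.coframe_frame hz]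
  obtain ⟨h1, h2⟩ := e.nonneg_of_futureCausal_frame hz h
  have hm := e.g_frame_neg hz
  have ha := e.du_right z hz
  have hb := e.dv_left z hz
  have h3 := hl.2
  rw [e.g_frame hz] at h3
  unfold Rightward at ha hr
  unfold Leftward at hb
  rw [e.frame_eq z d] at hr
  simp only [map_add, map_smul, add_apply, smul_apply, smul_eq_mul] at hr
  have h4 : 0 < d.1 := by by_contra! hc; nlinarith
  have h5 : d.1 * d.2 + d.2 * d.1 = 0 := (mul_eq_zero.mp h3).resolve_right hm.ne
  exact ⟨h4, by nlinarith⟩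

lemma coframe_left {x : X} (hx : x ∈ e.toChart.source) {v : TangentSpace (𝓡 2) x}
    (h : M.FutureCausal v) (hl : M.Lightlike v) (hr : M.Leftward v) :
    (e.coframe x v).1 = 0 ∧ 0 < (e.coframe x v).2 := by
  obtain ⟨z, hz, rfl⟩ := e.exists_of_mem_source hx
  obtain ⟨d, rfl⟩ := e.exists_frame hz v
  rw [e.coframe_frame hz]
  obtain ⟨h1, h2⟩ := e.nonneg_of_futureCausal_frame hz h
  have hm := e.g_frame_neg hz
  have ha := e.du_right z hz
  have hb := e.dv_left z hz
  have h3 := hl.2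
  rw [e.g_frame hz] at h3
  unfold Rightward at ha
  unfold Leftward at hb hr
  rw [e.frame_eq z d] at hr
  simp only [map_add, map_smul, add_apply, smul_apply, smul_eq_mul] at hr
  have h4 : 0 < d.2 := by by_contra! hc; nlinarith
  have h5 : d.1 * d.2 + d.2 * d.1 = 0 := (mul_eq_zero.mp h3).resolve_right hm.ne
  exact ⟨by nlinarith, h4⟩

lemma hasDerivWithinAt_coord {γ : ℝ → X} {s : Set ℝ} {t : ℝ} {v : TangentSpace (𝓡 2) (γ t)}
    (h : HasVelocity γ s t v) (hx : γ t ∈ e.toChart.source) :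
    HasDerivWithinAt (fun t ↦ e.toChart (γ t)) (e.coframe (γ t) v) s t := by
  have h2 := (e.mdifferentiableAt hx).hasMFDerivAt.comp_hasMFDerivWithinAt t h
  have h3 : (mfderiv (𝓡 2) 𝓘(ℝ, ℝ × ℝ) e.toChart (γ t)).comp
      ((1 : ℝ →L[ℝ] ℝ).smulRight v : ℝ →L[ℝ] TangentSpace (𝓡 2) (γ t)) =
      ((1 : ℝ →L[ℝ] ℝ).smulRight (e.coframe (γ t) v) : ℝ →L[ℝ] ℝ × ℝ) := by
    ext1
    change e.coframe (γ t) ((1 : ℝ) • v) = (1 : ℝ) • e.coframe (γ t) v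
    rw [map_smul]
  have h4 := (hasMFDerivWithinAt_iff_hasFDerivWithinAt.mp h2)
  exact (h3 ▸ h4 : HasFDerivWithinAt _ ((1 : ℝ →L[ℝ] ℝ).smulRight (e.coframe (γ t) v)) s t)

lemma hasDerivWithinAt_fst {f : ℝ → ℝ × ℝ} {d : ℝ × ℝ} {s : Set ℝ} {t : ℝ}
    (h : HasDerivWithinAt f d s t) : HasDerivWithinAt (fun t ↦ (f t).1) d.1 s t :=
  (hasFDerivAt_fst (𝕜 := ℝ) (E := ℝ) (F := ℝ)).comp_hasDerivWithinAt t h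

lemma hasDerivWithinAt_snd {f : ℝ → ℝ × ℝ} {d : ℝ × ℝ} {s : Set ℝ} {t : ℝ}
    (h : HasDerivWithinAt f d s t) : HasDerivWithinAt (fun t ↦ (f t).2) d.2 s t :=
  (hasFDerivAt_snd (𝕜 := ℝ) (E := ℝ) (F := ℝ)).comp_hasDerivWithinAt t h

/-- Null coordinates increase along future-directed causal curves. -/
lemma coord_le {γ : ℝ → X} {a b : ℝ} (hab : a ≤ b) (hs : ∀ t ∈ Icc a b, γ t ∈ e.toChart.source)
    (h : ∀ t ∈ Icc a b, ∃ v, HasVelocity γ (Icc a b) t v ∧ M.FutureCausal v) :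
    e.toChart (γ a) ≤ e.toChart (γ b) := by
  have key : ∀ t ∈ Icc a b, ∃ d : ℝ × ℝ,
      HasDerivWithinAt (fun t ↦ e.toChart (γ t)) d (Icc a b) t ∧ 0 ≤ d.1 ∧ 0 ≤ d.2 := by
    intro t ht
    obtain ⟨v, hv, hc⟩ := h t ht
    exact ⟨_, e.hasDerivWithinAt_coord hv (hs t ht), e.coframe_nonneg (hs t ht) hc⟩
  have ha : a ∈ Icc a b := ⟨le_rfl, hab⟩
  have hb : b ∈ Icc a b := ⟨hab, le_rfl⟩
  choose! d hd hd1 hd2 using key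
  have hin : interior (Icc a b) ⊆ Icc a b := interior_subset
  constructor
  · refine monotoneOn_of_hasDerivWithinAt_nonneg (f := fun t ↦ (e.toChart (γ t)).1)
      (f' := fun t ↦ (d t).1) (convex_Icc a b) (fun t ht ↦ ?_) (fun t ht ↦ ?_)
      (fun t ht ↦ hd1 t (hin ht)) ha hb hab
    · exact (hasDerivWithinAt_fst (hd t ht)).continuousWithinAt
    · exact (hasDerivWithinAt_fst (hd t (hin ht))).mono hin
  · refine monotoneOn_of_hasDerivWithinAt_nonneg (f := fun t ↦ (e.toChart (γ t)).2)
      (f' := fun t ↦ (d t).2) (convex_Icc a b) (fun t ht ↦ ?_) (fun t ht ↦ ?_)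
      (fun t ht ↦ hd2 t (hin ht)) ha hb hab
    · exact (hasDerivWithinAt_snd (hd t ht)).continuousWithinAt
    · exact (hasDerivWithinAt_snd (hd t (hin ht))).mono hin

end NullChart

lemma CausalStep.sub {Y : Set X} {p q : X} {γ : ℝ → X} {a b : ℝ} (hp : γ a = p) (hq : γ b = q)
    (hc : ContMDiffOn 𝓘(ℝ, ℝ) (𝓡 2) 1 γ (Icc a b))
    (h : ∀ t ∈ Icc a b, γ t ∈ Y ∧ ∃ v, HasVelocity γ (Icc a b) t v ∧ M.FutureCausal v)
    {t : ℝ} (ht : t ∈ Icc a b) : M.CausalLE Y p (γ t) ∧ M.CausalLE Y (γ t) q := by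
  subst hp hq
  constructor
  · rcases ht.1.eq_or_lt with rfl | h1
    · exact .refl
    · have hs : Icc a t ⊆ Icc a b := Icc_subset_Icc_right ht.2
      refine .single ⟨γ, a, t, h1, rfl, rfl, hc.mono hs, fun s hs' ↦ ⟨(h s (hs hs')).1, ?_⟩⟩
      obtain ⟨v, hv, hv'⟩ := (h s (hs hs')).2
      exact ⟨v, HasMFDerivWithinAt.mono hv hs, hv'⟩
  · rcases ht.2.eq_or_lt with rfl | h1
    · exact .refl
    · have hs : Icc t b ⊆ Icc a b := Icc_subset_Icc_left ht.1
      refine .single ⟨γ, t, b, h1, rfl, rfl, hc.mono hs, fun s hs' ↦ ⟨(h s (hs hs')).1, ?_⟩⟩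
      obtain ⟨v, hv, hv'⟩ := (h s (hs hs')).2
      exact ⟨v, HasMFDerivWithinAt.mono hv hs, hv'⟩

lemma CausalLE.mem {Y : Set X} {p q : X} (hp : p ∈ Y) (h : M.CausalLE Y p q) : q ∈ Y := by
  induction h with
  | refl => exact hp
  | tail _ h _ =>
    obtain ⟨γ, a, b, hab, -, rfl, -, h⟩ := h
    exact (h b ⟨hab.le, le_rfl⟩).1

namespace CausalDiamond

variable (D : CausalDiamond M)

/-- The closed diamond. -/
def closedRegion : Set X := M.future D.Y D.p ∩ M.past D.Y D.q

lemma closedRegion_eq :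
    D.closedRegion = D.chart.toChart.symm '' (Icc D.u₀ D.u₁ ×ˢ Icc D.v₀ D.v₁) := D.inter_eq

lemma closedRegion_subset_source : D.closedRegion ⊆ D.chart.toChart.source := by
  rw [closedRegion_eq]
  rintro _ ⟨z, hz, rfl⟩
  exact D.chart.toChart.map_target (D.rect_subset hz)

lemma coord_mem {x : X} (hx : x ∈ D.closedRegion) :
    D.chart.toChart x ∈ Icc D.u₀ D.u₁ ×ˢ Icc D.v₀ D.v₁ := by
  rw [closedRegion_eq] at hx
  obtain ⟨z, hz, rfl⟩ := hx
  rwa [D.chart.toChart.right_inv (D.rect_subset hz)]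

lemma symm_mem {z : ℝ × ℝ} (hz : z ∈ Icc D.u₀ D.u₁ ×ˢ Icc D.v₀ D.v₁) :
    D.chart.toChart.symm z ∈ D.closedRegion := by
  rw [closedRegion_eq]
  exact ⟨z, hz, rfl⟩

lemma symm_coord {x : X} (hx : x ∈ D.closedRegion) :
    D.chart.toChart.symm (D.chart.toChart x) = x :=
  D.chart.toChart.left_inv (D.closedRegion_subset_source hx)

lemma closedRegion_subset_Y : D.closedRegion ⊆ D.Y := fun _ h ↦ CausalLE.mem D.p_mem h.1

/-- In the closed diamond, causally related points have ordered coordinates. -/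
lemma coord_le {a b : X} (h : M.CausalLE D.Y a b) (ha : M.CausalLE D.Y D.p a)
    (hb : M.CausalLE D.Y b D.q) : D.chart.toChart a ≤ D.chart.toChart b := by
  induction h using Relation.ReflTransGen.head_induction_on with
  | refl => exact le_rfl
  | head hac hcb ih =>
    refine le_trans ?_ (ih (ha.tail hac))
    obtain ⟨γ, s, t, hst, h1, h2, hc, h⟩ := hac
    have hs : ∀ r ∈ Icc s t, γ r ∈ D.chart.toChart.source := fun r hr ↦ by
      obtain ⟨h3, h4⟩ := CausalStep.sub h1 h2 hc h hr
      exact D.closedRegion_subset_source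
        ⟨Relation.ReflTransGen.trans ha h3, (Relation.ReflTransGen.trans h4 hcb).trans hb⟩
    have := D.chart.coord_le hst.le hs fun r hr ↦ (h r hr).2
    rwa [h1, h2] at this

/-- In the closed diamond, points with ordered coordinates are causally related. -/
lemma causalLE_of_le {z z' : ℝ × ℝ} (hz : z ∈ Icc D.u₀ D.u₁ ×ˢ Icc D.v₀ D.v₁)
    (hz' : z' ∈ Icc D.u₀ D.u₁ ×ˢ Icc D.v₀ D.v₁) (h : z ≤ z') :
    M.CausalLE D.Y (D.chart.toChart.symm z) (D.chart.toChart.symm z') := by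
  rcases eq_or_ne z z' with rfl | hne
  · exact .refl
  have hmem : ∀ t ∈ Icc (0 : ℝ) 1, z + t • (z' - z) ∈ Icc D.u₀ D.u₁ ×ˢ Icc D.v₀ D.v₁ := by
    intro t ht
    exact ((convex_Icc _ _).prod (convex_Icc _ _)).add_smul_sub_mem hz hz' ht
  have hd : ∀ t, HasDerivAt (fun t : ℝ ↦ z + t • (z' - z)) (z' - z) t := fun t ↦ by
    simpa using ((hasDerivAt_id t).smul_const (z' - z)).const_add z
  refine .single ⟨fun t ↦ D.chart.toChart.symm (z + t • (z' - z)), 0, 1, zero_lt_one, by simp,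
    by simp, D.chart.curve_contMDiffOn (c := fun t ↦ z + t • (z' - z)) (by fun_prop)
      (fun t ht ↦ D.rect_subset (hmem t ht)),
    fun t ht ↦ ⟨D.closedRegion_subset_Y (D.symm_mem (hmem t ht)), _,
      D.chart.curve_hasVelocity (hd t) (D.rect_subset (hmem t ht)),
      D.chart.futureCausal_frame (D.rect_subset (hmem t ht)) ?_ ?_ ?_⟩⟩
  · exact sub_nonneg.mpr h.1
  · exact sub_nonneg.mpr h.2
  · exact sub_ne_zero.mpr hne.symm

/-- A smaller coordinate rectangle is again a causal diamond. -/
def sub {u₀ u₁ v₀ v₁ : ℝ} (h₁ : D.u₀ ≤ u₀) (hu : u₀ < u₁) (h₂ : u₁ ≤ D.u₁)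
    (h₃ : D.v₀ ≤ v₀) (hv : v₀ < v₁) (h₄ : v₁ ≤ D.v₁) : CausalDiamond M where
  Y := D.Y
  hyperbolic := D.hyperbolic
  p := D.chart.toChart.symm (u₀, v₀)
  q := D.chart.toChart.symm (u₁, v₁)
  p_mem := D.closedRegion_subset_Y (D.symm_mem
    ⟨⟨h₁, hu.le.trans h₂⟩, ⟨h₃, hv.le.trans h₄⟩⟩)
  q_mem := D.closedRegion_subset_Y (D.symm_mem
    ⟨⟨h₁.trans hu.le, h₂⟩, ⟨h₃.trans hv.le, h₄⟩⟩)
  chart := D.chart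
  u₀ := u₀
  u₁ := u₁
  v₀ := v₀
  v₁ := v₁
  u_lt := hu
  v_lt := hv
  rect_subset := (prod_mono (Icc_subset_Icc h₁ h₂) (Icc_subset_Icc h₃ h₄)).trans D.rect_subset
  p_eq := rfl
  q_eq := rfl
  inter_eq := by
    have hsub : Icc u₀ u₁ ×ˢ Icc v₀ v₁ ⊆ Icc D.u₀ D.u₁ ×ˢ Icc D.v₀ D.v₁ :=
      prod_mono (Icc_subset_Icc h₁ h₂) (Icc_subset_Icc h₃ h₄)
    have hp : (u₀, v₀) ∈ Icc u₀ u₁ ×ˢ Icc v₀ v₁ := ⟨⟨le_rfl, hu.le⟩, ⟨le_rfl, hv.le⟩⟩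
    have hq : (u₁, v₁) ∈ Icc u₀ u₁ ×ˢ Icc v₀ v₁ := ⟨⟨hu.le, le_rfl⟩, ⟨hv.le, le_rfl⟩⟩
    have hp' := D.symm_mem (hsub hp)
    have hq' := D.symm_mem (hsub hq)
    apply Subset.antisymm
    · rintro r ⟨h5, h6⟩
      have hr : r ∈ D.closedRegion :=
        ⟨Relation.ReflTransGen.trans hp'.1 h5, Relation.ReflTransGen.trans h6 hq'.2⟩
      have h7 := D.coord_le h5 hp'.1 hr.2
      have h8 := D.coord_le h6 hr.1 hq'.2
      rw [D.chart.toChart.right_inv (D.rect_subset (hsub hp))] at h7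
      rw [D.chart.toChart.right_inv (D.rect_subset (hsub hq))] at h8
      exact ⟨_, ⟨⟨h7.1, h8.1⟩, ⟨h7.2, h8.2⟩⟩, D.symm_coord hr⟩
    · rintro _ ⟨z, hz, rfl⟩
      exact ⟨D.causalLE_of_le (hsub hp) (hsub hz) ⟨hz.1.1, hz.2.1⟩,
        D.causalLE_of_le (hsub hz) (hsub hq) ⟨hz.1.2, hz.2.2⟩⟩

/-! ### Paths in a diamond -/

lemma up_self {u v : ℝ} (h₁ : D.u₀ ≤ u) (h : u ≤ u) (h₂ : u ≤ D.u₁) (hv₀ : D.v₀ ≤ v)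
    (hv₁ : v ≤ D.v₁) {x : X} (hx hy : D.chart.toChart.symm (u, v) = x) :
    D.up h₁ h h₂ hv₀ hv₁ hx hy = 𝟙 _ :=
  Segment.path_const _ rfl

lemma down_self {u v : ℝ} (h₁ : v ≤ D.v₁) (h : v ≤ v) (h₂ : D.v₀ ≤ v) (hu₀ : D.u₀ ≤ u)
    (hu₁ : u ≤ D.u₁) {x : X} (hx hy : D.chart.toChart.symm (u, v) = x) :
    D.down h₁ h h₂ hu₀ hu₁ hx hy = 𝟙 _ :=
  Segment.path_const _ rfl

lemma up_comp_up {u₁ u₂ u₃ v : ℝ} (h₁ : D.u₀ ≤ u₁) (h : u₁ ≤ u₂) (h₂ : u₂ ≤ D.u₁)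
    (h₂' : D.u₀ ≤ u₂) (h' : u₂ ≤ u₃) (h₃ : u₃ ≤ D.u₁) (hv₀ : D.v₀ ≤ v) (hv₁ : v ≤ D.v₁)
    {x y z : X} (hx : D.chart.toChart.symm (u₁, v) = x)
    (hy : D.chart.toChart.symm (u₂, v) = y) (hz : D.chart.toChart.symm (u₃, v) = z) :
    D.up h₁ h h₂ hv₀ hv₁ hx hy ≫ D.up h₂' h' h₃ hv₀ hv₁ hy hz =
      D.up h₁ (h.trans h') h₃ hv₀ hv₁ hx hz := by
  unfold up
  symm
  apply Segment.path_cut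
  exacts [rfl, rfl, rfl, fun _ _ ↦ rfl, fun _ _ ↦ rfl]

lemma down_comp_down {u v₁ v₂ v₃ : ℝ} (h₁ : v₁ ≤ D.v₁) (h : v₂ ≤ v₁) (h₂ : D.v₀ ≤ v₂)
    (h₂' : v₂ ≤ D.v₁) (h' : v₃ ≤ v₂) (h₃ : D.v₀ ≤ v₃) (hu₀ : D.u₀ ≤ u) (hu₁ : u ≤ D.u₁)
    {x y z : X} (hx : D.chart.toChart.symm (u, v₁) = x)
    (hy : D.chart.toChart.symm (u, v₂) = y) (hz : D.chart.toChart.symm (u, v₃) = z) :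
    D.down h₁ h h₂ hu₀ hu₁ hx hy ≫ D.down h₂' h' h₃ hu₀ hu₁ hy hz =
      D.down h₁ (h'.trans h) h₃ hu₀ hu₁ hx hz := by
  unfold down
  symm
  apply Segment.path_cut
  exacts [rfl, rfl, rfl, fun _ _ ↦ rfl, fun _ _ ↦ rfl]

/-- A coordinate rectangle in the closed diamond gives a 2-morphism. -/
lemma sweep_rect {u₀ u₁ v₀ v₁ : ℝ} (h₁ : D.u₀ ≤ u₀) (hu : u₀ ≤ u₁) (h₂ : u₁ ≤ D.u₁)
    (h₃ : D.v₀ ≤ v₀) (hv : v₀ ≤ v₁) (h₄ : v₁ ≤ D.v₁) {x y p q : X}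
    (hx : D.chart.toChart.symm (u₀, v₁) = x) (hq : D.chart.toChart.symm (u₁, v₁) = q)
    (hp : D.chart.toChart.symm (u₀, v₀) = p) (hy : D.chart.toChart.symm (u₁, v₀) = y) :
    Sweep (D.up h₁ hu h₂ (h₃.trans hv) h₄ hx hq ≫ D.down h₄ hv h₃ (h₁.trans hu) h₂ hq hy)
      (D.down h₄ hv h₃ h₁ (hu.trans h₂) hx hp ≫ D.up h₁ hu h₂ h₃ (hv.trans h₄) hp hy) := by
  subst hx hy hp hq
  rcases hu.eq_or_lt with rfl | hu'
  · rw [up_self, up_self, Category.id_comp, Category.comp_id]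
    exact .refl _
  rcases hv.eq_or_lt with rfl | hv'
  · rw [down_self, down_self, Category.id_comp, Category.comp_id]
    exact .refl _
  have := Sweep.diamond (D.sub h₁ hu' h₂ h₃ hv' h₄) (𝟙 _) (𝟙 _)
  simp only [Category.id_comp, Category.comp_id] at this
  exact this

end CausalDiamond

namespace CausalDiamond

variable (D : CausalDiamond M)

/-- The path from the left corner of the diamond to a point `x` of the closed diamond: down along
the past boundary to the lightlike projection of `x`, then up to `x`. -/
def fromLeft {x : X} (hx : x ∈ D.closedRegion) : (⟨D.left⟩ : PathTwoCat M) ⟶ ⟨x⟩ :=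
  D.down (u := D.u₀) le_rfl (D.coord_mem hx).2.2 (D.coord_mem hx).2.1 le_rfl D.u_lt.le D.left_eq
      rfl ≫
    D.up le_rfl (D.coord_mem hx).1.1 (D.coord_mem hx).1.2 (D.coord_mem hx).2.1
      (D.coord_mem hx).2.2 rfl (D.symm_coord hx)

/-- The path from a point `x` of the closed diamond to the right corner: down to the lightlike
projection of `x` to the past boundary, then up along the past boundary. -/
def toRight {x : X} (hx : x ∈ D.closedRegion) : (⟨x⟩ : PathTwoCat M) ⟶ ⟨D.right⟩ :=
  D.down (D.coord_mem hx).2.2 (D.coord_mem hx).2.1 le_rfl (D.coord_mem hx).1.1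
      (D.coord_mem hx).1.2 (D.symm_coord hx) rfl ≫
    D.up (v := D.v₀) (D.coord_mem hx).1.1 (D.coord_mem hx).1.2 le_rfl le_rfl D.v_lt.le rfl
      D.right_eq

lemma left_mem : D.left ∈ D.closedRegion :=
  D.symm_mem ⟨⟨le_rfl, D.u_lt.le⟩, ⟨D.v_lt.le, le_rfl⟩⟩

lemma right_mem : D.right ∈ D.closedRegion :=
  D.symm_mem ⟨⟨D.u_lt.le, le_rfl⟩, ⟨le_rfl, D.v_lt.le⟩⟩

lemma p_mem_closedRegion : D.p ∈ D.closedRegion := by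
  rw [← D.p_eq]
  exact D.symm_mem ⟨⟨le_rfl, D.u_lt.le⟩, ⟨le_rfl, D.v_lt.le⟩⟩

lemma isCompact_closedRegion : IsCompact D.closedRegion :=
  D.hyperbolic.isCompact _ D.p_mem _ D.q_mem

variable {D} {D' : CausalDiamond M}

/-- If the open diamonds are nested, so are the closed ones. -/
lemma closedRegion_mono [T2Space X] (h : D'.region ⊆ D.region) :
    D'.closedRegion ⊆ D.closedRegion := by
  have h1 : D'.chart.toChart.symm '' (Ioo D'.u₀ D'.u₁ ×ˢ Ioo D'.v₀ D'.v₁) ⊆ D'.region := by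
    refine interior_maximal ?_ ?_
    · rw [D'.inter_eq]
      exact image_mono (Set.prod_mono Ioo_subset_Icc_self Ioo_subset_Icc_self)
    · exact D'.chart.toChart.isOpen_image_symm_of_subset_target (isOpen_Ioo.prod isOpen_Ioo)
        ((Set.prod_mono Ioo_subset_Icc_self Ioo_subset_Icc_self).trans D'.rect_subset)
  have h2 : D'.region ⊆ D.closedRegion := h.trans interior_subset
  have h3 : closure D'.region ⊆ D.closedRegion :=
    closure_minimal h2 D.isCompact_closedRegion.isClosed
  refine Subset.trans ?_ h3
  rw [closedRegion_eq]
  have h4 : closure (Ioo D'.u₀ D'.u₁ ×ˢ Ioo D'.v₀ D'.v₁) = Icc D'.u₀ D'.u₁ ×ˢ Icc D'.v₀ D'.v₁ := by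
    rw [closure_prod_eq, closure_Ioo D'.u_lt.ne, closure_Ioo D'.v_lt.ne]
  have h5 : ContinuousOn D'.chart.toChart.symm (closure (Ioo D'.u₀ D'.u₁ ×ˢ Ioo D'.v₀ D'.v₁)) := by
    rw [h4]
    exact D'.chart.toChart.continuousOn_symm.mono D'.rect_subset
  rw [← h4]
  exact h5.image_closure.trans (closure_mono h1)

/-- Change of null coordinates along a coordinate line of `u`. -/
lemma coord_up (hD : D'.closedRegion ⊆ D.closedRegion) {v : ℝ} (hv : v ∈ Icc D'.v₀ D'.v₁) :
    ContinuousOn (fun u ↦ (D.chart.toChart (D'.chart.toChart.symm (u, v))).1)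
        (Icc D'.u₀ D'.u₁) ∧
      StrictMonoOn (fun u ↦ (D.chart.toChart (D'.chart.toChart.symm (u, v))).1)
        (Icc D'.u₀ D'.u₁) ∧
      ∀ u ∈ Icc D'.u₀ D'.u₁, (D.chart.toChart (D'.chart.toChart.symm (u, v))).2 =
        (D.chart.toChart (D'.chart.toChart.symm (D'.u₀, v))).2 := by
  have key : ∀ u ∈ Icc D'.u₀ D'.u₁, ∃ d : ℝ × ℝ,
      (∀ s, HasDerivWithinAt (fun u ↦ D.chart.toChart (D'.chart.toChart.symm (u, v))) d s u) ∧
        0 < d.1 ∧ d.2 = 0 := by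
    intro u hu
    have ht := D'.mem_target hu hv
    have hs := D.closedRegion_subset_source (hD (D'.symm_mem (z := (u, v)) ⟨hu, hv⟩))
    have hd : HasDerivAt (fun t : ℝ ↦ (t, v)) (1, 0) u :=
      (hasDerivAt_id u).prodMk (hasDerivAt_const u v)
    exact ⟨_, fun s ↦ D.chart.hasDerivWithinAt_coord (D'.chart.curve_hasVelocity hd ht) hs,
      D.chart.coframe_right hs (D'.chart.du_future _ ht) (D'.chart.du_lightlike _ ht)
        (D'.chart.du_right _ ht)⟩
  choose! d hd hd1 hd2 using key
  have hin : interior (Icc D'.u₀ D'.u₁) ⊆ Icc D'.u₀ D'.u₁ := interior_subset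
  have hc : ContinuousOn (fun u ↦ (D.chart.toChart (D'.chart.toChart.symm (u, v))).1)
      (Icc D'.u₀ D'.u₁) :=
    fun u hu ↦ (NullChart.hasDerivWithinAt_fst (hd u hu _)).continuousWithinAt
  refine ⟨hc, ?_, ?_⟩
  · exact strictMonoOn_of_hasDerivWithinAt_pos (f' := fun u ↦ (d u).1) (convex_Icc _ _) hc
      (fun u hu ↦ NullChart.hasDerivWithinAt_fst (hd u (hin hu) _)) (fun u hu ↦ hd1 u (hin hu))
  · exact constant_of_has_deriv_right_zero
      (fun u hu ↦ (NullChart.hasDerivWithinAt_snd (hd u hu _)).continuousWithinAt)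
      (fun u hu ↦ by
        have hu' : u ∈ Icc D'.u₀ D'.u₁ := ⟨hu.1, hu.2.le⟩
        have := NullChart.hasDerivWithinAt_snd (hd u hu' (Ici u))
        rwa [hd2 u hu'] at this)

/-- Change of null coordinates along a coordinate line of `v`. -/
lemma coord_down (hD : D'.closedRegion ⊆ D.closedRegion) {u : ℝ} (hu : u ∈ Icc D'.u₀ D'.u₁) :
    ContinuousOn (fun v ↦ (D.chart.toChart (D'.chart.toChart.symm (u, v))).2)
        (Icc D'.v₀ D'.v₁) ∧
      StrictMonoOn (fun v ↦ (D.chart.toChart (D'.chart.toChart.symm (u, v))).2)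
        (Icc D'.v₀ D'.v₁) ∧
      ∀ v ∈ Icc D'.v₀ D'.v₁, (D.chart.toChart (D'.chart.toChart.symm (u, v))).1 =
        (D.chart.toChart (D'.chart.toChart.symm (u, D'.v₀))).1 := by
  have key : ∀ v ∈ Icc D'.v₀ D'.v₁, ∃ d : ℝ × ℝ,
      (∀ s, HasDerivWithinAt (fun v ↦ D.chart.toChart (D'.chart.toChart.symm (u, v))) d s v) ∧
        d.1 = 0 ∧ 0 < d.2 := by
    intro v hv
    have ht := D'.mem_target hu hv
    have hs := D.closedRegion_subset_source (hD (D'.symm_mem (z := (u, v)) ⟨hu, hv⟩))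
    have hd : HasDerivAt (fun t : ℝ ↦ (u, t)) (0, 1) v :=
      (hasDerivAt_const v u).prodMk (hasDerivAt_id v)
    exact ⟨_, fun s ↦ D.chart.hasDerivWithinAt_coord (D'.chart.curve_hasVelocity hd ht) hs,
      D.chart.coframe_left hs (D'.chart.dv_future _ ht) (D'.chart.dv_lightlike _ ht)
        (D'.chart.dv_left _ ht)⟩
  choose! d hd hd1 hd2 using key
  have hin : interior (Icc D'.v₀ D'.v₁) ⊆ Icc D'.v₀ D'.v₁ := interior_subset
  have hc : ContinuousOn (fun v ↦ (D.chart.toChart (D'.chart.toChart.symm (u, v))).2)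
      (Icc D'.v₀ D'.v₁) :=
    fun v hv ↦ (NullChart.hasDerivWithinAt_snd (hd v hv _)).continuousWithinAt
  refine ⟨hc, ?_, ?_⟩
  · exact strictMonoOn_of_hasDerivWithinAt_pos (f' := fun v ↦ (d v).2) (convex_Icc _ _) hc
      (fun v hv ↦ NullChart.hasDerivWithinAt_snd (hd v (hin hv) _)) (fun v hv ↦ hd2 v (hin hv))
  · exact constant_of_has_deriv_right_zero
      (fun v hv ↦ (NullChart.hasDerivWithinAt_fst (hd v hv _)).continuousWithinAt)
      (fun v hv ↦ by
        have hv' : v ∈ Icc D'.v₀ D'.v₁ := ⟨hv.1, hv.2.le⟩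
        have := NullChart.hasDerivWithinAt_fst (hd v hv' (Ici v))
        rwa [hd1 v hv'] at this)

lemma coord_symm {u v : ℝ} (hu₀ : D.u₀ ≤ u) (hu₁ : u ≤ D.u₁) (hv₀ : D.v₀ ≤ v) (hv₁ : v ≤ D.v₁) :
    D.chart.toChart (D.chart.toChart.symm (u, v)) = (u, v) :=
  D.chart.toChart.right_inv (D.mem_target ⟨hu₀, hu₁⟩ ⟨hv₀, hv₁⟩)

/-- The path along a coordinate line of `u` does not depend on the null coordinates. -/
lemma up_eq_up (hD : D'.closedRegion ⊆ D.closedRegion) {u₁ u₂ v a₁ a₂ b : ℝ} {x y : X}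
    (h₁ : D'.u₀ ≤ u₁) (h : u₁ ≤ u₂) (h₂ : u₂ ≤ D'.u₁) (hv₀ : D'.v₀ ≤ v) (hv₁ : v ≤ D'.v₁)
    (hx : D'.chart.toChart.symm (u₁, v) = x) (hy : D'.chart.toChart.symm (u₂, v) = y)
    (k₁ : D.u₀ ≤ a₁) (k : a₁ ≤ a₂) (k₂ : a₂ ≤ D.u₁) (hb₀ : D.v₀ ≤ b) (hb₁ : b ≤ D.v₁)
    (hx' : D.chart.toChart.symm (a₁, b) = x) (hy' : D.chart.toChart.symm (a₂, b) = y) :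
    D'.up h₁ h h₂ hv₀ hv₁ hx hy = D.up k₁ k k₂ hb₀ hb₁ hx' hy' := by
  obtain ⟨hc, hm, he⟩ := coord_up hD (v := v) ⟨hv₀, hv₁⟩
  have hsub : Icc u₁ u₂ ⊆ Icc D'.u₀ D'.u₁ := Icc_subset_Icc h₁ h₂
  have e₁ : D.chart.toChart (D'.chart.toChart.symm (u₁, v)) = (a₁, b) := by
    rw [hx, ← hx', coord_symm k₁ (k.trans k₂) hb₀ hb₁]
  have e₂ : D.chart.toChart (D'.chart.toChart.symm (u₂, v)) = (a₂, b) := by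
    rw [hy, ← hy', coord_symm (k₁.trans k) k₂ hb₀ hb₁]
  refine Segment.path_reparam _ _
    (fun u ↦ (D.chart.toChart (D'.chart.toChart.symm (u, v))).1) (hc.mono hsub) (hm.mono hsub)
    (congrArg Prod.fst e₁) (congrArg Prod.fst e₂) fun t ht ↦ ?_
  have h3 : (D.chart.toChart (D'.chart.toChart.symm (t, v))).2 = b := by
    rw [he t (hsub ht), ← he u₁ (hsub ⟨le_rfl, h⟩), e₁]
  change D'.chart.toChart.symm (t, v) =
    D.chart.toChart.symm ((D.chart.toChart (D'.chart.toChart.symm (t, v))).1, b)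
  have h4 := D.symm_coord (hD (D'.symm_mem (z := (t, v)) ⟨hsub ht, ⟨hv₀, hv₁⟩⟩))
  rw [← h3]
  exact h4.symm

/-- The path along a coordinate line of `v` does not depend on the null coordinates. -/
lemma down_eq_down (hD : D'.closedRegion ⊆ D.closedRegion) {u v₁ v₂ a b₁ b₂ : ℝ} {x y : X}
    (h₁ : v₁ ≤ D'.v₁) (h : v₂ ≤ v₁) (h₂ : D'.v₀ ≤ v₂) (hu₀ : D'.u₀ ≤ u) (hu₁ : u ≤ D'.u₁)
    (hx : D'.chart.toChart.symm (u, v₁) = x) (hy : D'.chart.toChart.symm (u, v₂) = y)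
    (k₁ : b₁ ≤ D.v₁) (k : b₂ ≤ b₁) (k₂ : D.v₀ ≤ b₂) (ha₀ : D.u₀ ≤ a) (ha₁ : a ≤ D.u₁)
    (hx' : D.chart.toChart.symm (a, b₁) = x) (hy' : D.chart.toChart.symm (a, b₂) = y) :
    D'.down h₁ h h₂ hu₀ hu₁ hx hy = D.down k₁ k k₂ ha₀ ha₁ hx' hy' := by
  obtain ⟨hc, hm, he⟩ := coord_down hD (u := u) ⟨hu₀, hu₁⟩
  have hneg : MapsTo (fun t : ℝ ↦ -t) (Icc (-v₁) (-v₂)) (Icc D'.v₀ D'.v₁) :=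
    fun t ht ↦ ⟨by linarith [ht.2], by linarith [ht.1]⟩
  have e₁ : D.chart.toChart (D'.chart.toChart.symm (u, v₁)) = (a, b₁) := by
    rw [hx, ← hx', coord_symm ha₀ ha₁ (k₂.trans k) k₁]
  have e₂ : D.chart.toChart (D'.chart.toChart.symm (u, v₂)) = (a, b₂) := by
    rw [hy, ← hy', coord_symm ha₀ ha₁ k₂ (k.trans k₁)]
  refine Segment.path_reparam _ _
    (fun t ↦ -(D.chart.toChart (D'.chart.toChart.symm (u, -t))).2)
    ((hc.comp continuous_neg.continuousOn hneg).neg) ?_ ?_ ?_ fun t ht ↦ ?_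
  · intro s hs t ht hst
    exact neg_lt_neg (hm (hneg ht) (hneg hs) (neg_lt_neg hst))
  · change -(D.chart.toChart (D'.chart.toChart.symm (u, - -v₁))).2 = -b₁
    rw [neg_neg, e₁]
  · change -(D.chart.toChart (D'.chart.toChart.symm (u, - -v₂))).2 = -b₂
    rw [neg_neg, e₂]
  have h3 : (D.chart.toChart (D'.chart.toChart.symm (u, -t))).1 = a := by
    rw [he (-t) (hneg ht), ← he v₁ ⟨h₂.trans h, h₁⟩, e₁]
  change D'.chart.toChart.symm (u, -t) =
    D.chart.toChart.symm (a, - -(D.chart.toChart (D'.chart.toChart.symm (u, -t))).2)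
  have h4 := D.symm_coord (hD (D'.symm_mem (z := (u, -t)) ⟨⟨hu₀, hu₁⟩, hneg ht⟩))
  rw [neg_neg, ← h3]
  exact h4.symm

/-- The 2-morphism `f'` of an inclusion of diamonds. -/
lemma sweep_inclusion (hD : D'.closedRegion ⊆ D.closedRegion) :
    Sweep (D.fromLeft (hD D'.left_mem) ≫ D'.pastBoundary ≫ D.toRight (hD D'.right_mem))
      D.pastBoundary := by
  have ml := hD D'.left_mem
  have mp := hD D'.p_mem_closedRegion
  have mr := hD D'.right_mem
  have cl := D.coord_mem ml
  have cp := D.coord_mem mp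
  have cr := D.coord_mem mr
  have sl := D.symm_coord ml
  have sp := D.symm_coord mp
  have sr := D.symm_coord mr
  have e1 : (D.chart.toChart D'.left).1 = (D.chart.toChart D'.p).1 := by
    rw [← D'.p_eq]
    exact (coord_down hD (u := D'.u₀) ⟨le_rfl, D'.u_lt.le⟩).2.2 _ ⟨D'.v_lt.le, le_rfl⟩
  have l1 : (D.chart.toChart D'.p).2 ≤ (D.chart.toChart D'.left).2 := by
    rw [← D'.p_eq]
    exact (coord_down hD (u := D'.u₀) ⟨le_rfl, D'.u_lt.le⟩).2.1.monotoneOn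
      ⟨le_rfl, D'.v_lt.le⟩ ⟨D'.v_lt.le, le_rfl⟩ D'.v_lt.le
  have e2 : (D.chart.toChart D'.right).2 = (D.chart.toChart D'.p).2 := by
    rw [← D'.p_eq]
    exact (coord_up hD (v := D'.v₀) ⟨le_rfl, D'.v_lt.le⟩).2.2 _ ⟨D'.u_lt.le, le_rfl⟩
  have l2 : (D.chart.toChart D'.p).1 ≤ (D.chart.toChart D'.right).1 := by
    rw [← D'.p_eq]
    exact (coord_up hD (v := D'.v₀) ⟨le_rfl, D'.v_lt.le⟩).2.1.monotoneOn
      ⟨le_rfl, D'.u_lt.le⟩ ⟨D'.u_lt.le, le_rfl⟩ D'.u_lt.le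
  unfold fromLeft toRight
  generalize_proofs
  generalize hcl : D.chart.toChart D'.left = zl at *
  generalize hcp : D.chart.toChart D'.p = zp at *
  generalize hcr : D.chart.toChart D'.right = zr at *
  obtain ⟨a₁, b₂⟩ := zl
  obtain ⟨a₁', b₁⟩ := zp
  obtain ⟨a₂, b₁'⟩ := zr
  obtain rfl : a₁ = a₁' := e1
  obtain rfl : b₁' = b₁ := e2
  obtain ⟨⟨cl1, cl2⟩, ⟨cl3, cl4⟩⟩ := cl
  obtain ⟨⟨cp1, cp2⟩, ⟨cp3, cp4⟩⟩ := cp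
  obtain ⟨⟨cr1, cr2⟩, ⟨cr3, cr4⟩⟩ := cr
  dsimp only at *
  have hpast : D'.pastBoundary = D.down cl4 l1 cp3 cl1 cl2 sl sp ≫
      D.up cl1 l2 cr2 cp3 cp4 sp sr := by
    unfold pastBoundary
    rw [down_eq_down hD _ _ _ _ _ _ _ cl4 l1 cp3 cl1 cl2 sl sp,
      up_eq_up hD _ _ _ _ _ _ _ cl1 l2 cr2 cp3 cp4 sp sr]
  rw [hpast]
  have s1 := D.sweep_rect le_rfl cl1 cl2 cp3 l1 cl4 rfl sl rfl sp
  have s2 := D.sweep_rect le_rfl cr1 cr2 le_rfl cp3 cp4 rfl sr D.p_eq rfl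
  have t1 := Sweep.whiskerLeft
    (D.down (u := D.u₀) le_rfl cl4 cl3 le_rfl D.u_lt.le D.left_eq rfl)
    (s1.whiskerRight (D.up cl1 l2 cr2 cp3 cp4 sp sr ≫
      D.down cp4 cp3 le_rfl cr1 cr2 sr rfl ≫
      D.up (v := D.v₀) cr1 cr2 le_rfl le_rfl D.v_lt.le rfl D.right_eq))
  have t2 := Sweep.whiskerLeft
    (D.down (u := D.u₀) le_rfl cp4 cp3 le_rfl D.u_lt.le D.left_eq rfl)
    (s2.whiskerRight (D.up (v := D.v₀) cr1 cr2 le_rfl le_rfl D.v_lt.le rfl D.right_eq))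
  simp only [Category.assoc] at t1 t2 ⊢
  refine t1.trans ?_
  rw [← Category.assoc (D.up _ _ _ _ _ _ _) (D.up _ _ _ _ _ _ _), up_comp_up,
    ← Category.assoc (D.down _ _ _ _ _ _ _) (D.down _ _ _ _ _ _ _), down_comp_down]
  refine t2.trans ?_
  rw [up_comp_up, ← Category.assoc, down_comp_down]
  exact .refl _

end CausalDiamond

/-! ### Nets of monoids on causal subsets -/

variable (M) in
/-- The causal subsets of (the open subset) `W` of `X`: the interiors of causal diamonds in globally
hyperbolic subsets of `W`. -/
@[ext]
structure CausalSubset (W : Set X) where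
  carrier : Set X
  exists_diamond : ∃ D : CausalDiamond M, D.Y ⊆ W ∧ D.region = carrier

/-- Causal subsets are ordered by inclusion. -/
instance (W : Set X) : PartialOrder (CausalSubset M W) :=
  PartialOrder.lift CausalSubset.carrier fun _ _ ↦ CausalSubset.ext

namespace CausalSubset

/-- A causal subset of `W`, as a causal subset of `X`. -/
def toUniv {W : Set X} (O : CausalSubset M W) : CausalSubset M univ where
  carrier := O.carrier
  exists_diamond := O.exists_diamond.imp fun _ h ↦ ⟨subset_univ _, h.2⟩

/-- A diamond whose interior is the causal subset `O`. Its closed rectangle is the closure of `O`, and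
lightlike segments do not depend on the null coordinates (`up_eq_up`, `down_eq_down`), so the corners
and the boundary paths only depend on `O`. -/
def diamond {W : Set X} (O : CausalSubset M W) : CausalDiamond M := O.exists_diamond.choose

lemma diamond_region {W : Set X} (O : CausalSubset M W) : O.diamond.region = O.carrier :=
  O.exists_diamond.choose_spec.2

lemma closedRegion_mono [T2Space X] {W : Set X} {O' O : CausalSubset M W} (h : O' ≤ O) :
    O'.diamond.closedRegion ⊆ O.diamond.closedRegion :=
  CausalDiamond.closedRegion_mono (by rw [diamond_region, diamond_region]; exact h)

end CausalSubset

variable (M) in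
/-- An assignment of monoids to the causal subsets of `W` and of homomorphisms to the inclusions. -/
structure PreNet (W : Set X) where
  obj : CausalSubset M W → Type w
  [monoid : ∀ O, Monoid (obj O)]
  map : ∀ {O' O : CausalSubset M W}, O' ≤ O → (obj O' →* obj O)

attribute [instance] PreNet.monoid

namespace PreNet

/-- The restriction to the causal subsets of `Y`. -/
def restrict (A : PreNet.{u, w} M univ) (Y : Set X) : PreNet.{u, w} M Y where
  obj O := A.obj O.toUniv
  map h := A.map (O' := CausalSubset.toUniv _) (O := CausalSubset.toUniv _) h

variable {W : Set X} (A : PreNet.{u, w} M W)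

/-- A net of monoids: a functor that sends all inclusions to injections. -/
structure IsNet : Prop where
  map_id (O : CausalSubset M W) : A.map (le_refl O) = MonoidHom.id _
  map_comp {O'' O' O : CausalSubset M W} (h' : O'' ≤ O') (h : O' ≤ O) :
    A.map (h'.trans h) = (A.map h).comp (A.map h')
  injective {O' O : CausalSubset M W} (h : O' ≤ O) : Function.Injective (A.map h)

/-- A net of local monoids: the monoids of two causal subsets of `O` that are spacelike separated
commute in the monoid of `O`. -/
structure IsLocalNet : Prop extends A.IsNet where
  commute {O₁ O₂ O : CausalSubset M W} (h₁ : O₁ ≤ O) (h₂ : O₂ ≤ O)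
    (hs : M.SpacelikeSeparated W O₁.carrier O₂.carrier) (a₁ : A.obj O₁) (a₂ : A.obj O₂) :
    Commute (A.map h₁ a₁) (A.map h₂ a₂)

/-- The time slice axiom: if a collection of causal subsets of `O` covers a Cauchy surface of `O`,
then the union of their monoids in the monoid of `O` is everything. -/
def TimeSlice : Prop :=
  ∀ (O : CausalSubset M W) (Sig : Set X), M.IsCauchySurface O.carrier Sig →
    ∀ (𝒰 : Set (CausalSubset M W)) (h : ∀ U ∈ 𝒰, U ≤ O), Sig ⊆ ⋃ U ∈ 𝒰, U.carrier →
      ⋃ (U) (hU : U ∈ 𝒰), range (A.map (h U hU)) = univ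

end PreNet

/-! ### The net of a 2-functor -/

section NetOfFunctor

variable {C : Type u₁} [Bicategory.{w₁, v₁} C]

variable (C) in
/-- All 1-morphisms are invertible up to 2-isomorphism. A bicategory with this property in which
all 2-morphisms are invertible is a 2-groupoid. -/
def OneMorphismsInvertible : Prop :=
  ∀ {a b : C} (f : a ⟶ b), ∃ g : b ⟶ a, Nonempty (f ≫ g ≅ 𝟙 a) ∧ Nonempty (g ≫ f ≅ 𝟙 b)

/-- Horizontal composition with the images of the 1-morphisms under `Z` is injective on
2-morphisms. -/
def HorizontallyInjective (Z : Pseudofunctor (PathTwoCat M) C) : Prop :=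
  ∀ {x y : PathTwoCat M} (f : x ⟶ y) (c : C),
    (∀ g h : Z.obj y ⟶ c, Function.Injective (fun η : g ⟶ h ↦ Z.map f ◁ η)) ∧
    (∀ g h : c ⟶ Z.obj x, Function.Injective (fun η : g ⟶ h ↦ η ▷ Z.map f))

variable [Bicategory.IsLocallyGroupoid C] (Z : Pseudofunctor (PathTwoCat M) C)
  {D D' : CausalDiamond M} (hD : D'.closedRegion ⊆ D.closedRegion)

/-- The image under `Z` of the 2-morphism of an inclusion of diamonds. Its source is the past
boundary of the smaller diamond, extended on both sides by the lightlike projections of its corners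
to the past boundary of the larger one, its target is the past boundary of the larger diamond. -/
def inclusionIso : Z.map (D.fromLeft (hD D'.left_mem)) ≫ Z.map D'.pastBoundary ≫
    Z.map (D.toRight (hD D'.right_mem)) ≅ Z.map D.pastBoundary :=
  Bicategory.whiskerLeftIso _ (Z.mapComp _ _).symm ≪≫ (Z.mapComp _ _).symm ≪≫
    asIso (Z.map₂ (⟨CausalDiamond.sweep_inclusion hD⟩ :
      D.fromLeft (hD D'.left_mem) ≫ D'.pastBoundary ≫ D.toRight (hD D'.right_mem) ⟶
        D.pastBoundary))

/-- Extend an endomorphism by whiskering on both sides, then conjugate with `inclusionIso`. -/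
def inclusionHom : End (Z.map D'.pastBoundary) →* End (Z.map D.pastBoundary) :=
  (inclusionIso Z hD).conj.toMonoidHom.comp
    (((Bicategory.precomp _ (Z.map (D.fromLeft (hD D'.left_mem)))).mapEnd _).comp
      ((Bicategory.postcomp _ (Z.map (D.toRight (hD D'.right_mem)))).mapEnd _))

lemma inclusionHom_apply (a : End (Z.map D'.pastBoundary)) :
    inclusionHom Z hD a = (inclusionIso Z hD).inv ≫
      (Z.map (D.fromLeft (hD D'.left_mem)) ◁ (show Z.map D'.pastBoundary ⟶ _ from a) ▷
        Z.map (D.toRight (hD D'.right_mem))) ≫ (inclusionIso Z hD).hom := rfl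

/-- The assignment `O ↦ End (Z (past boundary of O))`. -/
def netOf [T2Space X] : PreNet.{u, w₁} M univ where
  obj O := End (Z.map O.diamond.pastBoundary)
  map h := inclusionHom Z (CausalSubset.closedRegion_mono h)

end NetOfFunctor

end LorentzSurface

end

/-!
A point `x` of a closed diamond weakly to the left of another point `y` is linked to it by the
path that runs first down and then up. Consecutive links sweep a rectangle on the way to the direct
link, and the links of a smaller diamond are links of the larger one. As parallel 2-morphisms of the
path 2-category agree, this yields functoriality. If two causal subsets of `O` are spacelike
separated, one of them lies to the left of the other; a link from the right corner of the first to
the left corner of the second turns their two inclusions into whiskerings of disjoint segments of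
one path, and the exchange law makes the two images commute. Whiskering with a quasi-invertible
1-morphism is an equivalence, so that every inclusion is sent to a bijection; a Cauchy surface is
nonempty, being met by the diagonal of the diamond, and the time slice axiom follows.
-/

/-! ### Endomorphism monoids of images under a pseudofunctor -/

noncomputable section EndomorphismMonoids

open Bicategory

universe w₂ v₂ u₂

variable {B : Type u₂} [Bicategory.{w₂, v₂} B] {C : Type u₁} [Bicategory.{w₁, v₁} C]
  (Z : Pseudofunctor B C)

/-- Whiskering with `Z.map l` on the left, conjugated with the compositor of `Z`. -/
def endWhiskerLeft {x y z : B} (l : x ⟶ y) {f : y ⟶ z} :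
    End (Z.map f) →* End (Z.map (l ≫ f)) :=
  (Z.mapComp l f).symm.conj.toMonoidHom.comp ((Bicategory.precomp _ (Z.map l)).mapEnd _)

/-- Whiskering with `Z.map r` on the right, conjugated with the compositor of `Z`. -/
def endWhiskerRight {x y z : B} {f : x ⟶ y} (r : y ⟶ z) :
    End (Z.map f) →* End (Z.map (f ≫ r)) :=
  (Z.mapComp f r).symm.conj.toMonoidHom.comp ((Bicategory.postcomp _ (Z.map r)).mapEnd _)

/-- Whiskering on both sides, with the result read as an endomorphism of the image of the composite
`l ≫ f ≫ r`. -/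
def endExtend {w x y z : B} (l : w ⟶ x) {f : x ⟶ y} (r : y ⟶ z) :
    End (Z.map f) →* End (Z.map (l ≫ f ≫ r)) :=
  (endWhiskerLeft Z l).comp (endWhiskerRight Z r)

/-- Conjugation with the image of a 2-morphism of `B`, which is invertible as `C` is locally a
groupoid. -/
def endTransport [IsLocallyGroupoid C] {x y : B} {f g : x ⟶ y} (s : f ⟶ g) :
    End (Z.map f) ≃* End (Z.map g) :=
  (asIso (Z.map₂ s)).conj

lemma endWhiskerLeft_apply {x y z : B} (l : x ⟶ y) {f : y ⟶ z} (a : Z.map f ⟶ Z.map f) :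
    endWhiskerLeft Z l a = (Z.mapComp l f).hom ≫ (Z.map l ◁ a) ≫ (Z.mapComp l f).inv := rfl

lemma endWhiskerRight_apply {x y z : B} {f : x ⟶ y} (r : y ⟶ z) (a : Z.map f ⟶ Z.map f) :
    endWhiskerRight Z r a = (Z.mapComp f r).hom ≫ (a ▷ Z.map r) ≫ (Z.mapComp f r).inv := rfl

lemma commute_endWhiskerRight_endWhiskerLeft {x y z : B} {f : x ⟶ y} {g : y ⟶ z}
    (a : End (Z.map f)) (b : End (Z.map g)) :
    Commute (endWhiskerRight Z g a) (endWhiskerLeft Z f b) := by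
  change endWhiskerLeft Z f b ≫ endWhiskerRight Z g a = endWhiskerRight Z g a ≫ endWhiskerLeft Z f b
  simp [endWhiskerLeft_apply, endWhiskerRight_apply, whisker_exchange_assoc]

variable [IsLocallyGroupoid C]

lemma endTransport_eq_iff {x y : B} {f g : x ⟶ y} (s : f ⟶ g) (a : Z.map f ⟶ Z.map f)
    (b : Z.map g ⟶ Z.map g) :
    endTransport Z s a = b ↔ a ≫ Z.map₂ s = Z.map₂ s ≫ b :=
  (asIso (Z.map₂ s)).inv_comp_eq

lemma endTransport_comp {x y : B} {f g h : x ⟶ y} (s : f ⟶ g) (t : g ⟶ h) (a : End (Z.map f)) :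
    endTransport Z (s ≫ t) a = endTransport Z t (endTransport Z s a) := by
  have hs := (endTransport_eq_iff Z s a _).mp rfl
  have ht := (endTransport_eq_iff Z t (endTransport Z s a) _).mp rfl
  rw [endTransport_eq_iff, Z.map₂_comp, ← Category.assoc, hs, Category.assoc, ht, Category.assoc]

lemma endTransport_whiskerLeft {x y z : B} (l : x ⟶ y) {f g : y ⟶ z} (s : f ⟶ g)
    (a : End (Z.map f)) :
    endTransport Z (l ◁ s) (endWhiskerLeft Z l a) = endWhiskerLeft Z l (endTransport Z s a) := by
  have hs := congrArg (Z.map l ◁ ·) ((endTransport_eq_iff Z s a _).mp rfl)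
  simp only [Bicategory.whiskerLeft_comp] at hs
  rw [endTransport_eq_iff]
  simp [endWhiskerLeft_apply, reassoc_of% hs]

lemma endTransport_whiskerRight {x y z : B} {f g : x ⟶ y} (s : f ⟶ g) (r : y ⟶ z)
    (a : End (Z.map f)) :
    endTransport Z (s ▷ r) (endWhiskerRight Z r a) = endWhiskerRight Z r (endTransport Z s a) := by
  have hs := congrArg (· ▷ Z.map r) ((endTransport_eq_iff Z s a _).mp rfl)
  simp only [Bicategory.comp_whiskerRight] at hs
  rw [endTransport_eq_iff]
  simp [endWhiskerRight_apply, reassoc_of% hs]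

lemma endTransport_whiskerRight_endWhiskerLeft {x y z : B} {l l' : x ⟶ y} (s : l ⟶ l')
    {f : y ⟶ z} (a : End (Z.map f)) :
    endTransport Z (s ▷ f) (endWhiskerLeft Z l a) = endWhiskerLeft Z l' a := by
  rw [endTransport_eq_iff]
  simp [endWhiskerLeft_apply, whisker_exchange_assoc]

lemma endTransport_whiskerLeft_endWhiskerRight {x y z : B} {f : x ⟶ y} {r r' : y ⟶ z}
    (s : r ⟶ r') (a : End (Z.map f)) :
    endTransport Z (f ◁ s) (endWhiskerRight Z r a) = endWhiskerRight Z r' a := by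
  rw [endTransport_eq_iff]
  simp [endWhiskerRight_apply, whisker_exchange_assoc]

lemma endTransport_associator_endWhiskerLeft {w x y z : B} (l : w ⟶ x) (l' : x ⟶ y) {f : y ⟶ z}
    (a : End (Z.map f)) :
    endTransport Z (α_ l l' f).hom (endWhiskerLeft Z (l ≫ l') a) =
      endWhiskerLeft Z l (endWhiskerLeft Z l' a) := by
  rw [endTransport_eq_iff]
  simp [endWhiskerLeft_apply, whisker_exchange_assoc]

lemma endTransport_associator_endWhiskerRight {w x y z : B} {f : w ⟶ x} (r : x ⟶ y) (r' : y ⟶ z)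
    (a : End (Z.map f)) :
    endTransport Z (α_ f r r').hom (endWhiskerRight Z r' (endWhiskerRight Z r a)) =
      endWhiskerRight Z (r ≫ r') a := by
  rw [endTransport_eq_iff]
  simp [endWhiskerRight_apply, whisker_exchange_assoc]

lemma endTransport_associator_endWhiskerRight_endWhiskerLeft {w x y z : B} (l : w ⟶ x) {f : x ⟶ y}
    (r : y ⟶ z) (a : End (Z.map f)) :
    endTransport Z (α_ l f r).hom (endWhiskerRight Z r (endWhiskerLeft Z l a)) =
      endWhiskerLeft Z l (endWhiskerRight Z r a) := by
  rw [endTransport_eq_iff]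
  simp [endWhiskerLeft_apply, endWhiskerRight_apply]

lemma endTransport_leftUnitor {x y : B} {f : x ⟶ y} (a : End (Z.map f)) :
    endTransport Z (λ_ f).hom (endWhiskerLeft Z (𝟙 x) a) = a := by
  rw [endTransport_eq_iff]
  simp [endWhiskerLeft_apply, whisker_exchange_assoc]

lemma endTransport_rightUnitor {x y : B} {f : x ⟶ y} (a : End (Z.map f)) :
    endTransport Z (ρ_ f).hom (endWhiskerRight Z (𝟙 y) a) = a := by
  rw [endTransport_eq_iff]
  simp [endWhiskerRight_apply, ← whisker_exchange_assoc]

lemma endTransport_endExtend {w x y z : B} {l l' : w ⟶ x} {f : x ⟶ y} {r r' : y ⟶ z}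
    (σ : l ⟶ l') (τ : r ⟶ r') (a : End (Z.map f)) :
    endTransport Z ((σ ▷ (f ≫ r)) ≫ (l' ◁ f ◁ τ)) (endExtend Z l r a) = endExtend Z l' r' a := by
  simp only [endExtend, MonoidHom.comp_apply, endTransport_comp,
    endTransport_whiskerRight_endWhiskerLeft, endTransport_whiskerLeft,
    endTransport_whiskerLeft_endWhiskerRight]

section Thin

variable [∀ x y : B, Quiver.IsThin (x ⟶ y)]

lemma endTransport_endExtend_id {x y : B} {f : x ⟶ y} (s : 𝟙 x ≫ f ≫ 𝟙 y ⟶ f)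
    (a : End (Z.map f)) : endTransport Z s (endExtend Z (𝟙 x) (𝟙 y) a) = a := by
  rw [Subsingleton.elim s ((λ_ _).hom ≫ (ρ_ f).hom), endTransport_comp, endExtend,
    MonoidHom.comp_apply, endTransport_leftUnitor, endTransport_rightUnitor]

lemma endTransport_endExtend_eq_of_hom {w x y z : B} {l l' : w ⟶ x} {f : x ⟶ y} {r r' : y ⟶ z}
    {g : w ⟶ z} (σ : l ⟶ l') (τ : r ⟶ r') (s : l ≫ f ≫ r ⟶ g) (s' : l' ≫ f ≫ r' ⟶ g)
    (a : End (Z.map f)) :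
    endTransport Z s (endExtend Z l r a) = endTransport Z s' (endExtend Z l' r' a) := by
  rw [← endTransport_endExtend Z σ τ, ← endTransport_comp]
  congr 2
  exact Subsingleton.elim _ _

lemma endTransport_endExtend_comp {x x' x'' y'' y' y : B} {l : x ⟶ x'} {l' : x' ⟶ x''}
    {f : x'' ⟶ y''} {r' : y'' ⟶ y'} {r : y' ⟶ y} {g' : x' ⟶ y'} {g : x ⟶ y}
    (s' : l' ≫ f ≫ r' ⟶ g') (s : l ≫ g' ≫ r ⟶ g) (t : (l ≫ l') ≫ f ≫ r' ≫ r ⟶ g)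
    (a : End (Z.map f)) :
    endTransport Z t (endExtend Z (l ≫ l') (r' ≫ r) a) =
      endTransport Z s (endExtend Z l r (endTransport Z s' (endExtend Z l' r' a))) := by
  let b := endExtend Z l r (endExtend Z l' r' a)
  let α : (l ≫ l') ≫ f ≫ r' ≫ r ⟶ l ≫ l' ≫ f ≫ r' ≫ r := (α_ l l' _).hom
  let β : l ≫ (l' ≫ f ≫ r') ≫ r ⟶ l ≫ l' ≫ f ≫ r' ≫ r :=
    l ◁ ((α_ l' (f ≫ r') r).hom ≫ (l' ◁ (α_ f r' r).hom))
  let u : l ≫ l' ≫ f ≫ r' ≫ r ⟶ g := (α_ l l' _).inv ≫ t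
  have hα : endTransport Z α (endExtend Z (l ≫ l') (r' ≫ r) a) = endTransport Z β b := by
    simp only [α, β, b, endExtend, MonoidHom.comp_apply, endTransport_whiskerLeft,
      endTransport_comp, endTransport_associator_endWhiskerLeft,
      endTransport_associator_endWhiskerRight_endWhiskerLeft,
      endTransport_associator_endWhiskerRight]
  have hs' : endTransport Z (l ◁ s' ▷ r) b =
      endExtend Z l r (endTransport Z s' (endExtend Z l' r' a)) := by
    simp only [b, endExtend, MonoidHom.comp_apply, endTransport_whiskerLeft,
      endTransport_whiskerRight]
  calc endTransport Z t (endExtend Z (l ≫ l') (r' ≫ r) a)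
    _ = endTransport Z (α ≫ u) (endExtend Z (l ≫ l') (r' ≫ r) a) := by
      rw [Subsingleton.elim t (α ≫ u)]
    _ = endTransport Z (β ≫ u) b := by rw [endTransport_comp, hα, ← endTransport_comp]
    _ = endTransport Z ((l ◁ s' ▷ r) ≫ s) b := by
      rw [Subsingleton.elim (β ≫ u) ((l ◁ s' ▷ r) ≫ s)]
    _ = endTransport Z s (endExtend Z l r (endTransport Z s' (endExtend Z l' r' a))) := by
      rw [endTransport_comp, hs']

-- After transport to `l₁ ≫ f₁ ≫ m ≫ f₂ ≫ r₂`, the two endomorphisms act on disjoint segments.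
lemma commute_endTransport_endExtend {x x₁ y₁ x₂ y₂ y : B} {l₁ : x ⟶ x₁} {f₁ : x₁ ⟶ y₁}
    {r₁ : y₁ ⟶ y} {l₂ : x ⟶ x₂} {f₂ : x₂ ⟶ y₂} {r₂ : y₂ ⟶ y} {g : x ⟶ y} (m : y₁ ⟶ x₂)
    (σ : l₁ ≫ f₁ ≫ m ⟶ l₂) (τ : m ≫ f₂ ≫ r₂ ⟶ r₁) (s₁ : l₁ ≫ f₁ ≫ r₁ ⟶ g)
    (s₂ : l₂ ≫ f₂ ≫ r₂ ⟶ g) (a₁ : End (Z.map f₁)) (a₂ : End (Z.map f₂)) :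
    Commute (endTransport Z s₁ (endExtend Z l₁ r₁ a₁))
      (endTransport Z s₂ (endExtend Z l₂ r₂ a₂)) := by
  let s : l₁ ≫ f₁ ≫ m ≫ f₂ ≫ r₂ ⟶ g := (l₁ ◁ f₁ ◁ τ) ≫ s₁
  let t : (l₁ ≫ f₁ ≫ m) ≫ f₂ ≫ r₂ ⟶ l₁ ≫ f₁ ≫ m ≫ f₂ ≫ r₂ := (α_ _ _ _).hom ≫ (l₁ ◁ (α_ _ _ _).hom)
  have h₁ : endTransport Z s₁ (endExtend Z l₁ r₁ a₁) =
      endTransport Z s (endWhiskerLeft Z l₁ (endWhiskerRight Z (m ≫ f₂ ≫ r₂) a₁)) :=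
    (endTransport_endExtend_eq_of_hom Z (𝟙 l₁) τ s s₁ a₁).symm
  have h₂ : endTransport Z s₂ (endExtend Z l₂ r₂ a₂) =
      endTransport Z s (endWhiskerLeft Z l₁ (endWhiskerLeft Z f₁ (endExtend Z m r₂ a₂))) := by
    rw [← endTransport_endExtend_eq_of_hom Z σ (𝟙 r₂) (t ≫ s) s₂ a₂]
    simp only [t, endExtend, MonoidHom.comp_apply, endTransport_comp,
      endTransport_associator_endWhiskerLeft, endTransport_whiskerLeft]
  rw [h₁, h₂]
  exact ((commute_endWhiskerRight_endWhiskerLeft Z a₁ _).map _).map (endTransport Z s)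

end Thin

end EndomorphismMonoids

namespace LorentzSurface

/-! ### Quasi-invertible 1-morphisms -/

section QuasiInvertible

variable {C : Type u₁} [Bicategory.{w₁, v₁} C]

/-- A 1-morphism is quasi-invertible if it is invertible up to 2-isomorphisms, which need not
satisfy the triangle identities. -/
def QuasiInvertible {a b : C} (f : a ⟶ b) : Prop :=
  ∃ g : b ⟶ a, Nonempty (f ≫ g ≅ 𝟙 a) ∧ Nonempty (g ≫ f ≅ 𝟙 b)

lemma QuasiInvertible.isEquivalence_precomp {a b : C} {f : a ⟶ b} (hf : QuasiInvertible f)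
    (c : C) : (Bicategory.precomp c f).IsEquivalence := by
  obtain ⟨g, ⟨i⟩, ⟨j⟩⟩ := hf
  exact .mk' (Bicategory.precomp c g)
    ((Bicategory.leftUnitorNatIso b c).symm ≪≫ (Bicategory.precomposing b b c).mapIso j.symm ≪≫
      Bicategory.associatorNatIsoRight g f c)
    ((Bicategory.associatorNatIsoRight f g c).symm ≪≫ (Bicategory.precomposing a a c).mapIso i ≪≫
      Bicategory.leftUnitorNatIso a c)

lemma QuasiInvertible.isEquivalence_postcomp {a b : C} {f : a ⟶ b} (hf : QuasiInvertible f)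
    (c : C) : (Bicategory.postcomp c f).IsEquivalence := by
  obtain ⟨g, ⟨i⟩, ⟨j⟩⟩ := hf
  exact .mk' (Bicategory.postcomp c g)
    ((Bicategory.rightUnitorNatIso c a).symm ≪≫ (Bicategory.postcomposing c a a).mapIso i.symm ≪≫
      (Bicategory.associatorNatIsoLeft c f g).symm)
    (Bicategory.associatorNatIsoLeft c g f ≪≫ (Bicategory.postcomposing c b b).mapIso j ≪≫
      Bicategory.rightUnitorNatIso c b)

end QuasiInvertible

variable {X : Type u} [TopologicalSpace X]
  [ChartedSpace (EuclideanSpace ℝ (Fin 2)) X] [IsManifold (𝓡 2) ∞ X] {M : LorentzSurface X}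

namespace CausalDiamond

variable (D : CausalDiamond M) {D' : CausalDiamond M}

/-! ### Coordinates of nested diamonds -/

lemma chart_p : D.chart.toChart D.p = (D.u₀, D.v₀) := by
  rw [← D.p_eq, coord_symm le_rfl D.u_lt.le le_rfl D.v_lt.le]

lemma chart_q : D.chart.toChart D.q = (D.u₁, D.v₁) := by
  rw [← D.q_eq, coord_symm D.u_lt.le le_rfl D.v_lt.le le_rfl]

lemma chart_left : D.chart.toChart D.left = (D.u₀, D.v₁) := by
  rw [← D.left_eq, coord_symm le_rfl D.u_lt.le D.v_lt.le le_rfl]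

lemma chart_right : D.chart.toChart D.right = (D.u₁, D.v₀) := by
  rw [← D.right_eq, coord_symm D.u_lt.le le_rfl le_rfl D.v_lt.le]

lemma q_mem_closedRegion : D.q ∈ D.closedRegion := by
  rw [← D.q_eq]
  exact D.symm_mem ⟨⟨D.u_lt.le, le_rfl⟩, ⟨D.v_lt.le, le_rfl⟩⟩

variable {D}

lemma coord_fst_le_iff (hD : D'.closedRegion ⊆ D.closedRegion) {x y : X}
    (hx : x ∈ D'.closedRegion) (hy : y ∈ D'.closedRegion) :
    (D.chart.toChart x).1 ≤ (D.chart.toChart y).1 ↔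
      (D'.chart.toChart x).1 ≤ (D'.chart.toChart y).1 := by
  have on_past_boundary : ∀ z ∈ D'.closedRegion, (D.chart.toChart z).1 =
      (D.chart.toChart (D'.chart.toChart.symm ((D'.chart.toChart z).1, D'.v₀))).1 := fun z hz ↦ by
    conv_lhs => rw [← D'.symm_coord hz]
    exact (coord_down hD (D'.coord_mem hz).1).2.2 _ (D'.coord_mem hz).2
  rw [on_past_boundary x hx, on_past_boundary y hy]
  exact (coord_up hD ⟨le_rfl, D'.v_lt.le⟩).2.1.le_iff_le (D'.coord_mem hx).1 (D'.coord_mem hy).1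

lemma coord_snd_le_iff (hD : D'.closedRegion ⊆ D.closedRegion) {x y : X}
    (hx : x ∈ D'.closedRegion) (hy : y ∈ D'.closedRegion) :
    (D.chart.toChart x).2 ≤ (D.chart.toChart y).2 ↔
      (D'.chart.toChart x).2 ≤ (D'.chart.toChart y).2 := by
  have on_past_boundary : ∀ z ∈ D'.closedRegion, (D.chart.toChart z).2 =
      (D.chart.toChart (D'.chart.toChart.symm (D'.u₀, (D'.chart.toChart z).2))).2 := fun z hz ↦ by
    conv_lhs => rw [← D'.symm_coord hz]
    exact (coord_up hD (D'.coord_mem hz).2).2.2 _ (D'.coord_mem hz).1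
  rw [on_past_boundary x hx, on_past_boundary y hy]
  exact (coord_down hD ⟨le_rfl, D'.u_lt.le⟩).2.1.le_iff_le (D'.coord_mem hx).2 (D'.coord_mem hy).2

lemma coord_fst_eq_iff (hD : D'.closedRegion ⊆ D.closedRegion) {x y : X}
    (hx : x ∈ D'.closedRegion) (hy : y ∈ D'.closedRegion) :
    (D.chart.toChart x).1 = (D.chart.toChart y).1 ↔
      (D'.chart.toChart x).1 = (D'.chart.toChart y).1 := by
  rw [le_antisymm_iff, le_antisymm_iff, coord_fst_le_iff hD hx hy, coord_fst_le_iff hD hy hx]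

lemma coord_snd_eq_iff (hD : D'.closedRegion ⊆ D.closedRegion) {x y : X}
    (hx : x ∈ D'.closedRegion) (hy : y ∈ D'.closedRegion) :
    (D.chart.toChart x).2 = (D.chart.toChart y).2 ↔
      (D'.chart.toChart x).2 = (D'.chart.toChart y).2 := by
  rw [le_antisymm_iff, le_antisymm_iff, coord_snd_le_iff hD hx hy, coord_snd_le_iff hD hy hx]

/-! ### Links between points of a closed diamond -/

variable (D) in
/-- `D.LeftOf x y`: in the closed diamond `D`, the point `x` lies weakly to the left of `y`, so
that the two points may be lightlike related or equal. -/
structure LeftOf (x y : X) : Prop where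
  mem_left : x ∈ D.closedRegion
  mem_right : y ∈ D.closedRegion
  fst_le : (D.chart.toChart x).1 ≤ (D.chart.toChart y).1
  snd_le : (D.chart.toChart y).2 ≤ (D.chart.toChart x).2

lemma LeftOf.trans {x y z : X} (h : D.LeftOf x y) (h' : D.LeftOf y z) : D.LeftOf x z :=
  ⟨h.mem_left, h'.mem_right, h.fst_le.trans h'.fst_le, h'.snd_le.trans h.snd_le⟩

lemma LeftOf.mono (hD : D'.closedRegion ⊆ D.closedRegion) {x y : X} (h : D'.LeftOf x y) :
    D.LeftOf x y :=
  ⟨hD h.mem_left, hD h.mem_right, (coord_fst_le_iff hD h.mem_left h.mem_right).mpr h.fst_le,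
    (coord_snd_le_iff hD h.mem_right h.mem_left).mpr h.snd_le⟩

lemma left_leftOf {x : X} (hx : x ∈ D.closedRegion) : D.LeftOf D.left x :=
  ⟨D.left_mem, hx, by rw [chart_left]; exact (D.coord_mem hx).1.1,
    by rw [chart_left]; exact (D.coord_mem hx).2.2⟩

lemma leftOf_right {x : X} (hx : x ∈ D.closedRegion) : D.LeftOf x D.right :=
  ⟨hx, D.right_mem, by rw [chart_right]; exact (D.coord_mem hx).1.2,
    by rw [chart_right]; exact (D.coord_mem hx).2.1⟩

/-- The path from `x` to a point `y` to the right of it that runs first down and then up. -/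
def link {x y : X} (h : D.LeftOf x y) : (⟨x⟩ : PathTwoCat M) ⟶ ⟨y⟩ :=
  D.down (u := (D.chart.toChart x).1) (v₂ := (D.chart.toChart y).2) (D.coord_mem h.mem_left).2.2
      h.snd_le (D.coord_mem h.mem_right).2.1 (D.coord_mem h.mem_left).1.1
      (D.coord_mem h.mem_left).1.2 (D.symm_coord h.mem_left) rfl ≫
    D.up (D.coord_mem h.mem_left).1.1 h.fst_le (D.coord_mem h.mem_right).1.2
      (D.coord_mem h.mem_right).2.1 (D.coord_mem h.mem_right).2.2 rfl (D.symm_coord h.mem_right)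

lemma down_comp_up_eq_link (hD : D'.closedRegion ⊆ D.closedRegion) {u₁ u₂ v₁ v₂ : ℝ} {x p y : X}
    (h : D.LeftOf x y) (hu₀ : D'.u₀ ≤ u₁) (hu : u₁ ≤ u₂) (hu₁ : u₂ ≤ D'.u₁)
    (hv₀ : D'.v₀ ≤ v₁) (hv : v₁ ≤ v₂) (hv₁ : v₂ ≤ D'.v₁)
    (hx : D'.chart.toChart.symm (u₁, v₂) = x) (hp : D'.chart.toChart.symm (u₁, v₁) = p)
    (hy : D'.chart.toChart.symm (u₂, v₁) = y) :
    D'.down hv₁ hv hv₀ hu₀ (hu.trans hu₁) hx hp ≫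
      D'.up hu₀ hu hu₁ hv₀ (hv.trans hv₁) hp hy = D.link h := by
  have mem {u v : ℝ} (h₁ : D'.u₀ ≤ u) (h₂ : u ≤ D'.u₁) (h₃ : D'.v₀ ≤ v) (h₄ : v ≤ D'.v₁) {z : X}
      (hz : D'.chart.toChart.symm (u, v) = z) :
      z ∈ D'.closedRegion ∧ D'.chart.toChart z = (u, v) := by
    subst hz
    exact ⟨D'.symm_mem ⟨⟨h₁, h₂⟩, ⟨h₃, h₄⟩⟩, coord_symm h₁ h₂ h₃ h₄⟩
  obtain ⟨mx, cx⟩ := mem hu₀ (hu.trans hu₁) (hv₀.trans hv) hv₁ hx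
  obtain ⟨mp, cp⟩ := mem hu₀ (hu.trans hu₁) hv₀ (hv.trans hv₁) hp
  obtain ⟨my, cy⟩ := mem (hu₀.trans hu) hu₁ hv₀ (hv.trans hv₁) hy
  have hp' : D.chart.toChart.symm ((D.chart.toChart x).1, (D.chart.toChart y).2) = p := by
    rw [(coord_fst_eq_iff hD mx mp).mpr (by rw [cx, cp]),
      (coord_snd_eq_iff hD my mp).mpr (by rw [cy, cp])]
    exact D.symm_coord (hD mp)
  subst hp'
  unfold link
  rw [← down_eq_down hD hv₁ hv hv₀ hu₀ (hu.trans hu₁) hx hp,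
    ← up_eq_up hD hu₀ hu hu₁ hv₀ (hv.trans hv₁) hp hy]

lemma link_eq_link (hD : D'.closedRegion ⊆ D.closedRegion) {x y : X} (h : D'.LeftOf x y) :
    D'.link h = D.link (h.mono hD) :=
  down_comp_up_eq_link hD (h.mono hD) _ _ _ _ _ _ _ _ _

lemma link_self {x : X} (h : D.LeftOf x x) : D.link h = 𝟙 _ := by
  have hx := D.symm_coord h.mem_left
  have m := D.coord_mem h.mem_left
  rw [← down_comp_up_eq_link subset_rfl h m.1.1 le_rfl m.1.2 m.2.1 le_rfl m.2.2 hx hx hx,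
    down_self, up_self, Category.comp_id]

lemma fromLeft_eq_link {x : X} (hx : x ∈ D.closedRegion) :
    D.fromLeft hx = D.link (left_leftOf hx) :=
  down_comp_up_eq_link subset_rfl _ _ _ _ _ _ _ _ _ _

lemma toRight_eq_link {x : X} (hx : x ∈ D.closedRegion) :
    D.toRight hx = D.link (leftOf_right hx) :=
  down_comp_up_eq_link subset_rfl _ _ _ _ _ _ _ _ _ _

lemma pastBoundary_eq_link : D.pastBoundary = D.link (left_leftOf D.right_mem) :=
  down_comp_up_eq_link subset_rfl _ _ _ _ _ _ _ _ _ _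

lemma sweep_link {x y z : X} (h : D.LeftOf x y) (h' : D.LeftOf y z) :
    Sweep (D.link h ≫ D.link h') (D.link (h.trans h')) := by
  have mx := D.coord_mem h.mem_left
  have my := D.coord_mem h.mem_right
  have mz := D.coord_mem h'.mem_right
  have s := D.sweep_rect mx.1.1 h.fst_le my.1.2 mz.2.1 h'.snd_le my.2.2 rfl
    (D.symm_coord h.mem_right) rfl rfl
  have t := (s.whiskerRight (D.up my.1.1 h'.fst_le mz.1.2 mz.2.1 mz.2.2 rfl
    (D.symm_coord h'.mem_right))).whiskerLeft
    (D.down mx.2.2 h.snd_le my.2.1 mx.1.1 mx.1.2 (D.symm_coord h.mem_left) rfl)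
  simp only [Category.assoc] at t
  simp only [link, Category.assoc]
  refine t.trans ?_
  rw [up_comp_up, ← Category.assoc, down_comp_down]
  exact .refl _

lemma sweep_fromLeft (hD : D'.closedRegion ⊆ D.closedRegion) {x : X} (hx : x ∈ D'.closedRegion) :
    Sweep (D.fromLeft (hD D'.left_mem) ≫ D'.fromLeft hx) (D.fromLeft (hD hx)) := by
  rw [fromLeft_eq_link, fromLeft_eq_link, fromLeft_eq_link, link_eq_link hD]
  exact sweep_link _ _

lemma sweep_toRight (hD : D'.closedRegion ⊆ D.closedRegion) {x : X} (hx : x ∈ D'.closedRegion) :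
    Sweep (D'.toRight hx ≫ D.toRight (hD D'.right_mem)) (D.toRight (hD hx)) := by
  rw [toRight_eq_link, toRight_eq_link, toRight_eq_link, link_eq_link hD]
  exact sweep_link _ _

lemma sweep_fromLeft_link (hD : D'.closedRegion ⊆ D.closedRegion) {x : X}
    (h : D.LeftOf D'.right x) :
    Sweep (D.fromLeft (hD D'.left_mem) ≫ D'.pastBoundary ≫ D.link h)
      (D.fromLeft h.mem_right) := by
  rw [fromLeft_eq_link, fromLeft_eq_link, pastBoundary_eq_link, link_eq_link hD]
  exact ((sweep_link _ h).whiskerLeft _).trans (sweep_link _ _)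

lemma sweep_link_toRight (hD : D'.closedRegion ⊆ D.closedRegion) {x : X}
    (h : D.LeftOf x D'.left) :
    Sweep (D.link h ≫ D'.pastBoundary ≫ D.toRight (hD D'.right_mem)) (D.toRight h.mem_left) := by
  rw [toRight_eq_link, toRight_eq_link, pastBoundary_eq_link, link_eq_link hD]
  exact ((sweep_link _ _).whiskerLeft _).trans (sweep_link h _)

end CausalDiamond

/-! ### Spacelike separated diamonds -/

lemma CausalLE.mono {Y Y' : Set X} (hY : Y ⊆ Y') {p q : X} (h : M.CausalLE Y p q) :
    M.CausalLE Y' p q :=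
  Relation.ReflTransGen.mono (r := M.CausalStep Y) (p := M.CausalStep Y')
    (fun _ _ ⟨γ, a, b, hab, ha, hb, hc, hγ⟩ ↦
      ⟨γ, a, b, hab, ha, hb, hc, fun t ht ↦ ⟨hY (hγ t ht).1, (hγ t ht).2⟩⟩) _ _ h

lemma SpacelikeSeparated.anti {Y Y' O₁ O₂ : Set X} (hY : Y ⊆ Y')
    (h : M.SpacelikeSeparated Y' O₁ O₂) : M.SpacelikeSeparated Y O₁ O₂ :=
  fun x₁ h₁ x₂ h₂ ↦ ⟨fun hc ↦ (h x₁ h₁ x₂ h₂).1 (hc.mono hY),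
    fun hc ↦ (h x₁ h₁ x₂ h₂).2 (hc.mono hY)⟩

lemma SpacelikeSeparated.symm {Y O₁ O₂ : Set X} (h : M.SpacelikeSeparated Y O₁ O₂) :
    M.SpacelikeSeparated Y O₂ O₁ :=
  fun x₂ h₂ x₁ h₁ ↦ (h x₁ h₁ x₂ h₂).symm

namespace CausalDiamond

variable {D D' D₁ D₂ : CausalDiamond M}

lemma coord_mem_Ioo_prod_Ioo {x : X} (hx : x ∈ D.region) :
    D.chart.toChart x ∈ Ioo D.u₀ D.u₁ ×ˢ Ioo D.v₀ D.v₁ := by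
  have himage : D.chart.toChart '' D.region ⊆ interior (Icc D.u₀ D.u₁ ×ˢ Icc D.v₀ D.v₁) :=
    interior_maximal (image_subset_iff.mpr fun y hy ↦ D.coord_mem (interior_subset hy))
      (D.chart.toChart.isOpen_image_of_subset_source isOpen_interior
        (interior_subset.trans D.closedRegion_subset_source))
  rw [interior_prod_eq, interior_Icc, interior_Icc] at himage
  exact himage (mem_image_of_mem _ hx)

variable (D) in
lemma region_eq : D.region = D.chart.toChart.symm '' (Ioo D.u₀ D.u₁ ×ˢ Ioo D.v₀ D.v₁) := by
  have hsub : Ioo D.u₀ D.u₁ ×ˢ Ioo D.v₀ D.v₁ ⊆ Icc D.u₀ D.u₁ ×ˢ Icc D.v₀ D.v₁ :=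
    Set.prod_mono Ioo_subset_Icc_self Ioo_subset_Icc_self
  apply Subset.antisymm
  · exact fun x hx ↦ ⟨_, coord_mem_Ioo_prod_Ioo hx, D.symm_coord (interior_subset hx)⟩
  · refine interior_maximal ?_ (D.chart.toChart.isOpen_image_symm_of_subset_target
      (isOpen_Ioo.prod isOpen_Ioo) (hsub.trans D.rect_subset))
    rw [D.inter_eq]
    exact image_mono hsub

variable (D) in
lemma closedRegion_subset_closure : D.closedRegion ⊆ closure D.region := by
  have h : closure (Ioo D.u₀ D.u₁ ×ˢ Ioo D.v₀ D.v₁) = Icc D.u₀ D.u₁ ×ˢ Icc D.v₀ D.v₁ := by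
    rw [closure_prod_eq, closure_Ioo D.u_lt.ne, closure_Ioo D.v_lt.ne]
  rw [region_eq, closedRegion_eq, ← h]
  refine ContinuousOn.image_closure ?_
  rw [h]
  exact D.chart.toChart.continuousOn_symm.mono D.rect_subset

lemma exists_mem_region (hD : D'.closedRegion ⊆ D.closedRegion) {x : X} (hx : x ∈ D'.closedRegion)
    {s : Set (ℝ × ℝ)} (hs : IsOpen s) (hxs : D.chart.toChart x ∈ s) :
    ∃ y ∈ D'.region, D.chart.toChart y ∈ s := by
  have hc := D.chart.toChart.continuousAt (D.closedRegion_subset_source (hD hx))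
  obtain ⟨y, hy, hy'⟩ := mem_closure_iff_nhds.mp (D'.closedRegion_subset_closure hx) _
    (hc.preimage_mem_nhds (hs.mem_nhds hxs))
  exact ⟨y, hy', hy⟩

lemma le_or_le_of_spacelikeSeparated (h₁ : D₁.closedRegion ⊆ D.closedRegion)
    (h₂ : D₂.closedRegion ⊆ D.closedRegion)
    (hs : M.SpacelikeSeparated D.Y D₁.region D₂.region) {x₁ x₂ : X} (hx₁ : x₁ ∈ D₁.closedRegion)
    (hx₂ : x₂ ∈ D₂.closedRegion) :
    (D.chart.toChart x₂).1 ≤ (D.chart.toChart x₁).1 ∨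
      (D.chart.toChart x₂).2 ≤ (D.chart.toChart x₁).2 := by
  by_contra! ⟨hu, hv⟩
  obtain ⟨c, hc₁, hc₂⟩ := exists_between hu
  obtain ⟨d, hd₁, hd₂⟩ := exists_between hv
  obtain ⟨y₁, hy₁, hlt₁⟩ := exists_mem_region h₁ hx₁ (isOpen_Iio.prod isOpen_Iio)
    (s := Iio c ×ˢ Iio d) ⟨hc₁, hd₁⟩
  obtain ⟨y₂, hy₂, hlt₂⟩ := exists_mem_region h₂ hx₂ (isOpen_Ioi.prod isOpen_Ioi)
    (s := Ioi c ×ˢ Ioi d) ⟨hc₂, hd₂⟩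
  have m₁ := h₁ (interior_subset hy₁)
  have m₂ := h₂ (interior_subset hy₂)
  have hle := D.causalLE_of_le (D.coord_mem m₁) (D.coord_mem m₂)
    ⟨(hlt₁.1.trans hlt₂.1).le, (hlt₁.2.trans hlt₂.2).le⟩
  rw [D.symm_coord m₁, D.symm_coord m₂] at hle
  exact (hs y₁ hy₁ y₂ hy₂).1 hle

lemma coord_left (hD : D'.closedRegion ⊆ D.closedRegion) :
    D.chart.toChart D'.left = ((D.chart.toChart D'.p).1, (D.chart.toChart D'.q).2) :=
  Prod.ext
    ((coord_fst_eq_iff hD D'.left_mem D'.p_mem_closedRegion).mpr (by rw [chart_left, chart_p]))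
    ((coord_snd_eq_iff hD D'.left_mem D'.q_mem_closedRegion).mpr (by rw [chart_left, chart_q]))

lemma coord_right (hD : D'.closedRegion ⊆ D.closedRegion) :
    D.chart.toChart D'.right = ((D.chart.toChart D'.q).1, (D.chart.toChart D'.p).2) :=
  Prod.ext
    ((coord_fst_eq_iff hD D'.right_mem D'.q_mem_closedRegion).mpr (by rw [chart_right, chart_q]))
    ((coord_snd_eq_iff hD D'.right_mem D'.p_mem_closedRegion).mpr (by rw [chart_right, chart_p]))

lemma coord_p_fst_lt_coord_q_fst (hD : D'.closedRegion ⊆ D.closedRegion) :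
    (D.chart.toChart D'.p).1 < (D.chart.toChart D'.q).1 := by
  rw [← not_le, coord_fst_le_iff hD D'.q_mem_closedRegion D'.p_mem_closedRegion, chart_p, chart_q,
    not_le]
  exact D'.u_lt

lemma coord_p_snd_lt_coord_q_snd (hD : D'.closedRegion ⊆ D.closedRegion) :
    (D.chart.toChart D'.p).2 < (D.chart.toChart D'.q).2 := by
  rw [← not_le, coord_snd_le_iff hD D'.q_mem_closedRegion D'.p_mem_closedRegion, chart_p, chart_q,
    not_le]
  exact D'.v_lt

-- Neither `p₁ ≤ q₂` nor `p₂ ≤ q₁` in the product order, and nondegeneracy forces the two failures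
-- to occur in different null coordinates.
lemma leftOf_or_leftOf_of_spacelikeSeparated (h₁ : D₁.closedRegion ⊆ D.closedRegion)
    (h₂ : D₂.closedRegion ⊆ D.closedRegion)
    (hs : M.SpacelikeSeparated D.Y D₁.region D₂.region) :
    D.LeftOf D₁.right D₂.left ∨ D.LeftOf D₂.right D₁.left := by
  have fst₁ := coord_p_fst_lt_coord_q_fst h₁
  have fst₂ := coord_p_fst_lt_coord_q_fst h₂
  have snd₁ := coord_p_snd_lt_coord_q_snd h₁
  have snd₂ := coord_p_snd_lt_coord_q_snd h₂
  rcases le_or_le_of_spacelikeSeparated h₁ h₂ hs D₁.p_mem_closedRegion D₂.q_mem_closedRegion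
    with hu | hv <;>
  rcases le_or_le_of_spacelikeSeparated h₂ h₁ hs.symm D₂.p_mem_closedRegion D₁.q_mem_closedRegion
    with hu' | hv'
  · linarith
  · exact .inr ⟨h₂ D₂.right_mem, h₁ D₁.left_mem, by rwa [coord_left h₁, coord_right h₂],
      by rwa [coord_left h₁, coord_right h₂]⟩
  · exact .inl ⟨h₁ D₁.right_mem, h₂ D₂.left_mem, by rwa [coord_left h₂, coord_right h₁],
      by rwa [coord_left h₂, coord_right h₁]⟩
  · linarith

/-! ### The diagonal of a diamond -/

variable (D)

/-- The curve in `D` that is affine in null coordinates up to the reparametrization by the sigmoid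
function, and runs from `D.p` at `-∞` to `D.q` at `∞`. -/
noncomputable def diagonal (t : ℝ) : X :=
  D.chart.toChart.symm (AffineMap.lineMap (D.u₀, D.v₀) (D.u₁, D.v₁) t.sigmoid)

lemma lineMap_sigmoid_mem_Ioo_prod_Ioo (t : ℝ) :
    AffineMap.lineMap (D.u₀, D.v₀) (D.u₁, D.v₁) t.sigmoid ∈
      Ioo D.u₀ D.u₁ ×ˢ Ioo D.v₀ D.v₁ := by
  have h₀ := Real.sigmoid_pos t
  have h₁ := Real.sigmoid_lt_one t
  rw [Set.mem_prod, AffineMap.fst_lineMap, AffineMap.snd_lineMap]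
  exact ⟨⟨(left_lt_lineMap_iff_lt h₀).mpr D.u_lt, (lineMap_lt_right_iff_lt h₁).mpr D.u_lt⟩,
    ⟨(left_lt_lineMap_iff_lt h₀).mpr D.v_lt, (lineMap_lt_right_iff_lt h₁).mpr D.v_lt⟩⟩

lemma lineMap_sigmoid_mem_target (t : ℝ) :
    AffineMap.lineMap (D.u₀, D.v₀) (D.u₁, D.v₁) t.sigmoid ∈ D.chart.toChart.target :=
  D.rect_subset (Set.prod_mono Ioo_subset_Icc_self Ioo_subset_Icc_self
    (D.lineMap_sigmoid_mem_Ioo_prod_Ioo t))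

lemma diagonal_mem_region (t : ℝ) : D.diagonal t ∈ D.region := by
  rw [region_eq]
  exact mem_image_of_mem _ (D.lineMap_sigmoid_mem_Ioo_prod_Ioo t)

lemma contMDiff_diagonal : ContMDiff 𝓘(ℝ, ℝ) (𝓡 2) 1 D.diagonal := by
  rw [← contMDiffOn_univ]
  exact D.chart.curve_contMDiffOn
    ((AffineMap.contDiff_lineMap _ _).comp (contDiff_sigmoid.of_le le_top))
    fun t _ ↦ D.lineMap_sigmoid_mem_target t

lemma exists_futureCausal_hasVelocity_diagonal (t : ℝ) :
    ∃ v, HasVelocity D.diagonal univ t v ∧ M.FutureCausal v := by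
  have hσ : 0 < t.sigmoid * (1 - t.sigmoid) :=
    mul_pos (Real.sigmoid_pos t) (sub_pos.mpr (Real.sigmoid_lt_one t))
  have hd := (AffineMap.hasDerivAt_lineMap (a := (D.u₀, D.v₀)) (b := (D.u₁, D.v₁))
    (x := t.sigmoid)).scomp t (Real.hasDerivAt_sigmoid t)
  have hu := mul_pos hσ (sub_pos.mpr D.u_lt)
  have hv := mul_pos hσ (sub_pos.mpr D.v_lt)
  exact ⟨_, D.chart.curve_hasVelocity hd (D.lineMap_sigmoid_mem_target t),
    D.chart.futureCausal_frame (D.lineMap_sigmoid_mem_target t) hu.le hv.le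
      fun h ↦ hu.ne' (congrArg Prod.fst h)⟩

lemma p_notMem_region : D.p ∉ D.region := fun h ↦ by
  have := (coord_mem_Ioo_prod_Ioo h).1.1
  rw [chart_p] at this
  exact this.false

lemma q_notMem_region : D.q ∉ D.region := fun h ↦ by
  have := (coord_mem_Ioo_prod_Ioo h).1.2
  rw [chart_q] at this
  exact this.false

lemma tendsto_diagonal {l : Filter ℝ} {s : ℝ} (hl : Tendsto Real.sigmoid l (𝓝 s))
    (hs : AffineMap.lineMap (D.u₀, D.v₀) (D.u₁, D.v₁) s ∈ D.chart.toChart.target) :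
    Tendsto D.diagonal l
      (𝓝 (D.chart.toChart.symm (AffineMap.lineMap (D.u₀, D.v₀) (D.u₁, D.v₁) s))) :=
  (D.chart.toChart.continuousAt_symm hs).tendsto.comp
    ((AffineMap.lineMap_continuous.tendsto s).comp hl)

lemma tendsto_diagonal_atBot : Tendsto D.diagonal atBot (𝓝 D.p) := by
  have h := D.tendsto_diagonal Real.tendsto_sigmoid_atBot
  rw [AffineMap.lineMap_apply_zero, D.p_eq] at h
  exact h (D.mem_target ⟨le_rfl, D.u_lt.le⟩ ⟨le_rfl, D.v_lt.le⟩)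

lemma tendsto_diagonal_atTop : Tendsto D.diagonal atTop (𝓝 D.q) := by
  have h := D.tendsto_diagonal Real.tendsto_sigmoid_atTop
  rw [AffineMap.lineMap_apply_one, D.q_eq] at h
  exact h (D.mem_target ⟨D.u_lt.le, le_rfl⟩ ⟨D.v_lt.le, le_rfl⟩)

lemma inextendibleCausalCurve_diagonal [T2Space X] :
    M.InextendibleCausalCurve D.region D.diagonal where
  contMDiff := D.contMDiff_diagonal
  mem := D.diagonal_mem_region
  causal := D.exists_futureCausal_hasVelocity_diagonal
  no_future_endpoint _ hr h :=
    D.q_notMem_region (tendsto_nhds_unique h D.tendsto_diagonal_atTop ▸ hr)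
  no_past_endpoint _ hr h :=
    D.p_notMem_region (tendsto_nhds_unique h D.tendsto_diagonal_atBot ▸ hr)

end CausalDiamond

/-! ### The net axioms -/

section NetAxioms

variable {C : Type u₁} [Bicategory.{w₁, v₁} C] (Z : Pseudofunctor (PathTwoCat M) C)

variable {Z} in
lemma horizontallyInjective_of_quasiInvertible
    (hZ : ∀ {x y : PathTwoCat M} (f : x ⟶ y), QuasiInvertible (Z.map f)) :
    HorizontallyInjective Z := fun f c ↦ by
  have := (hZ f).isEquivalence_precomp c
  have := (hZ f).isEquivalence_postcomp c
  exact ⟨fun _ _ ↦ (Bicategory.precomp c (Z.map f)).map_injective,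
    fun _ _ ↦ (Bicategory.postcomp c (Z.map f)).map_injective⟩

variable [Bicategory.IsLocallyGroupoid C] {D D' D'' D₁ D₂ : CausalDiamond M}

lemma inclusionHom_eq_endTransport (hD : D'.closedRegion ⊆ D.closedRegion)
    (a : End (Z.map D'.pastBoundary)) :
    inclusionHom Z hD a = endTransport Z ⟨CausalDiamond.sweep_inclusion hD⟩
      (endExtend Z (D.fromLeft (hD D'.left_mem)) (D.toRight (hD D'.right_mem)) a) := by
  rw [eq_comm, endTransport_eq_iff, inclusionHom_apply]
  simp [endExtend, endWhiskerLeft_apply, endWhiskerRight_apply, inclusionIso]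

lemma inclusionHom_self (a : End (Z.map D.pastBoundary)) :
    inclusionHom Z (subset_refl D.closedRegion) a = a := by
  have hl : D.fromLeft D.left_mem = 𝟙 _ := by
    rw [CausalDiamond.fromLeft_eq_link, CausalDiamond.link_self]
  have hr : D.toRight D.right_mem = 𝟙 _ := by
    rw [CausalDiamond.toRight_eq_link, CausalDiamond.link_self]
  rw [inclusionHom_eq_endTransport,
    endTransport_endExtend_eq_of_hom Z (eqToHom hl) (eqToHom hr) _ ((λ_ _).hom ≫ (ρ_ _).hom),
    endTransport_endExtend_id]

lemma inclusionHom_comp (h' : D''.closedRegion ⊆ D'.closedRegion)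
    (h : D'.closedRegion ⊆ D.closedRegion) (a : End (Z.map D''.pastBoundary)) :
    inclusionHom Z (h'.trans h) a = inclusionHom Z h (inclusionHom Z h' a) := by
  let σ : D.fromLeft (h D'.left_mem) ≫ D'.fromLeft (h' D''.left_mem) ⟶
    D.fromLeft (h (h' D''.left_mem)) := ⟨CausalDiamond.sweep_fromLeft h (h' D''.left_mem)⟩
  let τ : D'.toRight (h' D''.right_mem) ≫ D.toRight (h D'.right_mem) ⟶
    D.toRight (h (h' D''.right_mem)) := ⟨CausalDiamond.sweep_toRight h (h' D''.right_mem)⟩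
  let f'' : D.fromLeft (h (h' D''.left_mem)) ≫ D''.pastBoundary ≫
    D.toRight (h (h' D''.right_mem)) ⟶ D.pastBoundary :=
    ⟨CausalDiamond.sweep_inclusion (h'.trans h)⟩
  simp only [inclusionHom_eq_endTransport]
  rw [← endTransport_endExtend_eq_of_hom Z σ τ ((σ ▷ _) ≫ (_ ◁ _ ◁ τ) ≫ f'') f'',
    endTransport_endExtend_comp]

lemma commute_inclusionHom_of_leftOf (h₁ : D₁.closedRegion ⊆ D.closedRegion)
    (h₂ : D₂.closedRegion ⊆ D.closedRegion) (h : D.LeftOf D₁.right D₂.left)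
    (a₁ : End (Z.map D₁.pastBoundary)) (a₂ : End (Z.map D₂.pastBoundary)) :
    Commute (inclusionHom Z h₁ a₁) (inclusionHom Z h₂ a₂) := by
  rw [inclusionHom_eq_endTransport, inclusionHom_eq_endTransport]
  exact commute_endTransport_endExtend Z (CausalDiamond.link h)
    ⟨CausalDiamond.sweep_fromLeft_link h₁ h⟩ ⟨CausalDiamond.sweep_link_toRight h₂ h⟩ _ _ a₁ a₂

variable {Z} in
lemma HorizontallyInjective.injective_inclusionHom (hZ : HorizontallyInjective Z)
    (hD : D'.closedRegion ⊆ D.closedRegion) : Function.Injective (inclusionHom Z hD) :=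
  (inclusionIso Z hD).conj.injective.comp
    (((hZ (D.fromLeft (hD D'.left_mem)) _).1 _ _).comp
      ((hZ (D.toRight (hD D'.right_mem)) _).2 _ _))

variable {Z} in
lemma surjective_inclusionHom_of_quasiInvertible
    (hZ : ∀ {x y : PathTwoCat M} (f : x ⟶ y), QuasiInvertible (Z.map f))
    (hD : D'.closedRegion ⊆ D.closedRegion) : Function.Surjective (inclusionHom Z hD) := by
  have := (hZ (D.fromLeft (hD D'.left_mem))).isEquivalence_precomp (Z.obj ⟨D.right⟩)
  have := (hZ (D.toRight (hD D'.right_mem))).isEquivalence_postcomp (Z.obj ⟨D'.left⟩)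
  exact (inclusionIso Z hD).conj.surjective.comp
    ((Bicategory.precomp _ (Z.map (D.fromLeft (hD D'.left_mem)))).map_surjective.comp
      (Bicategory.postcomp _ (Z.map (D.toRight (hD D'.right_mem)))).map_surjective)

variable [T2Space X]

variable {Z} in
lemma HorizontallyInjective.isNet (hZ : HorizontallyInjective Z) : (netOf Z).IsNet where
  map_id _ := MonoidHom.ext (inclusionHom_self Z)
  map_comp h' h := MonoidHom.ext
    (inclusionHom_comp Z (CausalSubset.closedRegion_mono h') (CausalSubset.closedRegion_mono h))
  injective h := hZ.injective_inclusionHom (CausalSubset.closedRegion_mono h)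

lemma commute_map_restrict_netOf {Y : Set X} {O₁ O₂ O : CausalSubset M Y} (h₁ : O₁ ≤ O)
    (h₂ : O₂ ≤ O) (hs : M.SpacelikeSeparated Y O₁.carrier O₂.carrier)
    (a₁ : ((netOf Z).restrict Y).obj O₁) (a₂ : ((netOf Z).restrict Y).obj O₂) :
    Commute (((netOf Z).restrict Y).map h₁ a₁) (((netOf Z).restrict Y).map h₂ a₂) := by
  obtain ⟨E, hEY, hEO⟩ := O.exists_diamond
  have closedRegion_subset {U : CausalSubset M Y} (hU : U ≤ O) :
      U.toUniv.diamond.closedRegion ⊆ E.closedRegion :=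
    CausalDiamond.closedRegion_mono (by rw [CausalSubset.diamond_region, hEO]; exact hU)
  have hE : E.closedRegion ⊆ O.toUniv.diamond.closedRegion :=
    CausalDiamond.closedRegion_mono (by rw [CausalSubset.diamond_region, hEO]; exact subset_rfl)
  have hsE : M.SpacelikeSeparated E.Y O₁.toUniv.diamond.region O₂.toUniv.diamond.region := by
    rw [CausalSubset.diamond_region, CausalSubset.diamond_region]
    exact hs.anti hEY
  rcases CausalDiamond.leftOf_or_leftOf_of_spacelikeSeparated (closedRegion_subset h₁)
    (closedRegion_subset h₂) hsE with h | h
  · exact commute_inclusionHom_of_leftOf Z _ _ (h.mono hE) a₁ a₂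
  · exact (commute_inclusionHom_of_leftOf Z _ _ (h.mono hE) a₂ a₁).symm

variable {Z} in
lemma HorizontallyInjective.isLocalNet_restrict (hZ : HorizontallyInjective Z) (Y : Set X) :
    ((netOf Z).restrict Y).IsLocalNet where
  map_id O := hZ.isNet.map_id O.toUniv
  map_comp {O'' O' O} h' h :=
    hZ.isNet.map_comp (O'' := O''.toUniv) (O' := O'.toUniv) (O := O.toUniv) h' h
  injective {O' O} h := hZ.isNet.injective (O' := O'.toUniv) (O := O.toUniv) h
  commute := commute_map_restrict_netOf Z

lemma CausalSubset.nonempty_of_isCauchySurface {W : Set X} (O : CausalSubset M W) {S : Set X}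
    (hS : M.IsCauchySurface O.carrier S) : S.Nonempty := by
  obtain ⟨E, -, hEO⟩ := O.exists_diamond
  have hγ := E.inextendibleCausalCurve_diagonal
  rw [hEO] at hγ
  obtain ⟨t, ht, -⟩ := hS.2 _ hγ
  exact ⟨_, ht⟩

lemma timeSlice_restrict_of_surjective {A : PreNet.{u, w} M univ}
    (hA : ∀ {O' O : CausalSubset M univ} (h : O' ≤ O), Function.Surjective (A.map h)) (Y : Set X) :
    (A.restrict Y).TimeSlice := by
  intro O S hS 𝒰 h𝒰 hcover
  obtain ⟨x, hx⟩ := O.nonempty_of_isCauchySurface hS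
  obtain ⟨U, hU, -⟩ := mem_iUnion₂.mp (hcover hx)
  exact eq_univ_of_forall fun a ↦
    mem_iUnion₂.mpr ⟨U, hU, hA (O' := U.toUniv) (O := O.toUniv) (h𝒰 U hU) a⟩

end NetAxioms

end LorentzSurface

theorem mainTheorem4_general {X : Type u} [TopologicalSpace X] [T2Space X]
    [ChartedSpace (EuclideanSpace ℝ (Fin 2)) X] [IsManifold (𝓡 2) ∞ X] (M : LorentzSurface X)
    {C : Type u₁} [Bicategory.{w₁, v₁} C] [Bicategory.IsLocallyGroupoid C]
    (Z : Pseudofunctor M.PathTwoCat C) :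
    (LorentzSurface.HorizontallyInjective Z →
      (LorentzSurface.netOf Z).IsNet ∧
        ∀ Y : Set X, ((LorentzSurface.netOf Z).restrict Y).IsLocalNet) ∧
    ((∀ {x y : M.PathTwoCat} (f : x ⟶ y), LorentzSurface.QuasiInvertible (Z.map f)) →
      (LorentzSurface.netOf Z).IsNet ∧
        ∀ Y : Set X, ((LorentzSurface.netOf Z).restrict Y).IsLocalNet ∧
          ((LorentzSurface.netOf Z).restrict Y).TimeSlice) := by
  refine ⟨fun hZ ↦ ⟨hZ.isNet, hZ.isLocalNet_restrict⟩, fun hZ ↦ ?_⟩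
  have hinj : LorentzSurface.HorizontallyInjective Z :=
    LorentzSurface.horizontallyInjective_of_quasiInvertible hZ
  exact ⟨hinj.isNet, fun Y ↦ ⟨hinj.isLocalNet_restrict Y,
    LorentzSurface.timeSlice_restrict_of_surjective
      (fun _ ↦ LorentzSurface.surjective_inclusionHom_of_quasiInvertible hZ _) Y⟩⟩

theorem mainTheorem4 {X : Type u} [TopologicalSpace X] [T2Space X]
    [ChartedSpace (EuclideanSpace ℝ (Fin 2)) X] [IsManifold (𝓡 2) ∞ X] (M : LorentzSurface X)
    {C : Type u₁} [Bicategory.{w₁, v₁} C] [Bicategory.IsLocallyGroupoid C]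
    (Z : Pseudofunctor M.PathTwoCat C) :
    (LorentzSurface.HorizontallyInjective Z →
      (LorentzSurface.netOf Z).IsNet ∧
        ∀ Y : Set X, M.GloballyHyperbolic Y → ((LorentzSurface.netOf Z).restrict Y).IsLocalNet) ∧
    (LorentzSurface.OneMorphismsInvertible C →
      (LorentzSurface.netOf Z).IsNet ∧
        ∀ Y : Set X, M.GloballyHyperbolic Y →
          ((LorentzSurface.netOf Z).restrict Y).IsLocalNet ∧
          ((LorentzSurface.netOf Z).restrict Y).TimeSlice) := by
  exact (mainTheorem4_general M Z).imp (fun h hZ ↦ (h hZ).imp_right fun hY Y _ ↦ hY Y)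
    fun h hC ↦ (h fun f ↦ hC _).imp_right fun hY Y _ ↦ hY Y
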